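/- There is a deterministic distributed algorithm in the CONGEST model that finds all min-cuts of size $2$ of every connected network in $O(D)$ rounds. In detail: let $G=(V,E)$ be a finite, connected, undirected, unweighted, simple graph with $n$ vertices and diameter $D$. A cut-set of $G$ is the set of edges between $A$ and $V\setminus A$ for some $\emptyset\subsetneq A\subsetneq V$, and a min-cut is a cut-set with the least number of edges among all cut-sets of $G$. The vertices are computing nodes with distinct identifiers of at most $c\log_2 n$ bits ($\log_2$ rounded down); at the start a node knows only its own identifier and those of its neighbours. In each synchronous round every node sends to each neighbour a bit string determined by its state, and then updates its state from the strings it has received; local computation is unrestricted. A node that halts fixes its output, keeps its state and sends nothing from then on. There are one such deterministic algorithm and a constant $C$, and for every $c$ a constant $B$, such that on every such network $G$ with every such choice of identifiers: every message has at most $B\log_2 n$ bits; all nodes have halted after at most $C\cdot D$ rounds; every edge set that is output by some node is a min-cut of $G$ with exactly $2$ edges; and every min-cut of $G$ with exactly $2$ edges is output by at least one node that is an endpoint of one of its edges. -/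

import Mathlib

/-- The cut-set `δ(A)`: the edges of `G` with exactly one endpoint in `A`. -/
noncomputable def SimpleGraph.cutSet {V : Type} [Fintype V] (G : SimpleGraph V)
    (A : Finset V) : Finset (Sym2 V) :=
  open Classical in
  Finset.univ.filter fun e => e ∈ G.edgeSet ∧ ∃ u ∈ A, ∃ v ∉ A, e = s(u, v)

/-- `F` is a min-cut of `G`: the cut-set of a partition of the vertices into two nonempty parts,
with the least number of edges among all such cut-sets. -/
def SimpleGraph.IsMinCut {V : Type} [Fintype V] (G : SimpleGraph V)
    (F : Finset (Sym2 V)) : Prop :=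
  (∃ A : Finset V, A.Nonempty ∧ A ≠ Finset.univ ∧ F = G.cutSet A) ∧
    ∀ B : Finset V, B.Nonempty → B ≠ Finset.univ → F.card ≤ (G.cutSet B).card

/-- A deterministic synchronous message-passing algorithm, run by every node of a network, with
outputs in `O`. Messages are bit strings; the empty string means that nothing is sent. -/
structure DistributedAlgorithm (O : Type) where
  /-- the local states of a node -/
  State : Type
  /-- the initial state, computed from the node's own identifier and those of its neighbours -/
  init : ℕ → Finset ℕ → State
  /-- the message which a node in a given state sends to the neighbour with a given identifier -/
  send : State → ℕ → List Bool
  /-- the new state, computed from the old one and the messages received from the neighbours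
  (a function of the neighbour's identifier) -/
  receive : State → (ℕ → List Bool) → State
  /-- the output; a node halts as soon as it is in a state that has an output -/
  output : State → Option O

namespace DistributedAlgorithm

variable {O : Type} (A : DistributedAlgorithm O)
variable {V : Type} [Fintype V] (G : SimpleGraph V) (ident : V ↪ ℕ)

/-- The message sent by a node; a node that has halted sends nothing. -/
def outgoing (s : A.State) (i : ℕ) : List Bool :=
  if (A.output s).isSome then [] else A.send s i

/-- The messages that reach the node `u` when the states of the nodes are `σ`, by identifier of the
sender; only neighbours of `u` can send to `u`. -/
noncomputable def inbox (σ : V → A.State) (u : V) (i : ℕ) : List Bool :=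
  open Classical in
  if h : ∃ v, G.Adj u v ∧ ident v = i then A.outgoing (σ h.choose) (ident u) else []

theorem inbox_of_adj (σ : V → A.State) {u v : V} (h : G.Adj u v) :
    A.inbox G ident σ u (ident v) = A.outgoing (σ v) (ident u) := by
  have hex : ∃ w, G.Adj u w ∧ ident w = ident v := ⟨v, h, rfl⟩
  have hw : hex.choose = v := ident.injective hex.choose_spec.2
  rw [inbox, dif_pos hex, hw]

/-- The states of all nodes after `t` rounds; a node that has halted keeps its state. -/
noncomputable def stateAt : ℕ → V → A.State
  | 0, v =>
    open Classical in
    A.init (ident v) ((Finset.univ.filter fun w => G.Adj v w).map ident)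
  | t + 1, v =>
    if (A.output (stateAt t v)).isSome then stateAt t v
    else A.receive (stateAt t v) (A.inbox G ident (stateAt t) v)

/-- Every message sent over a link of the network, in any round, has at most `b` bits. -/
def UsesBandwidth (b : ℕ) : Prop :=
  ∀ (t : ℕ) (u v : V), G.Adj u v →
    (A.outgoing (A.stateAt G ident t u) (ident v)).length ≤ b

/-- Within `T` rounds every node has halted, and the output of each node `v` is `out v`. -/
def HaltsWithin (T : ℕ) (out : V → O) : Prop :=
  ∀ v, A.output (A.stateAt G ident T v) = some (out v)

end DistributedAlgorithm

/-- The outputs `out` of the nodes (each a finite list of edge sets, in terms of identifiers)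
together find all min-cuts of size `k`: nothing but min-cuts of size `k` is reported, and every
min-cut of size `k` is reported by a node incident to one of its edges. -/
def FindsAllMinCuts {V : Type} [Fintype V] (G : SimpleGraph V) (ident : V ↪ ℕ) (k : ℕ)
    (out : V → Finset (Finset (Sym2 ℕ))) : Prop :=
  (∀ v, ∀ S ∈ out v, ∃ F, G.IsMinCut F ∧ F.card = k ∧ S = F.map ident.sym2Map) ∧
    ∀ F, G.IsMinCut F → F.card = k → ∃ e ∈ F, ∃ v ∈ e, F.map ident.sym2Map ∈ out v

/-! Fix a rooted spanning tree of depth at most `d`, and let `cov u` be the non-tree edges leaving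
the subtree of `u`. If `cov u` is empty for some non-root `u`, the edge above `u` is a bridge and no
min-cut has size two. Otherwise every cut has at least two edges (`two_le_card_cutSet`), so the task
is to find all cuts of size two. Every cut contains a tree edge, which leaves three shapes
(`cut_cases`): a tree edge with the only non-tree edge covering it; two tree edges on one root path
with equal `cov`; two tree edges with disjoint subtrees whose `cov` agree up to orientation.

Each shape is recognized by counting. `crossCount u k` counts the non-tree edges from the subtree of
`u` to the outside of the subtree of its `k`-th ancestor. Equal counts force equal sets, which
settles the nested shape (`cov_eq_iff_ancestor`). For disjoint subtrees, all far ends of `cov u`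
must have the same ancestor `w` on one level, and `w` must have an equal count. Only sets with at
most one such ancestor matter, so `truncate` keeps messages of constant length. Since `k` names the
same level at `u` as `k + 1` does at a child, the sums for all levels are pipelined in `d + 1`
rounds. A first pass with identifiers as labels yields the counts `(cov v).card`; a second pass with
labels `info` carries these counts and the tree edges to the nodes that compare them.

The tree comes from flooding the smallest identifier. As `D` is unknown, the guesses `2 ^ k` are
tried in turn. After `r` rounds of flooding, an alarm of radius `2 * r + 1` tells every node whether
all leaders agree (`leader_eq_of_near`), so all nodes reject or accept a guess in the same round.
Guesses of at least `D` are accepted, and the costs form a geometric sum, which is `O(D)`. -/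

/-! ### Encoding lists of natural numbers as bit strings -/

/-- A self-delimiting encoding of lists of natural numbers as bit strings. -/
def encodeNats : List ℕ → List Bool
  | [] => []
  | n :: l => n.bits.flatMap (fun b => [true, b]) ++ false :: encodeNats l

/-- Every bit is announced by `true`, so the first `false` in an announcing position ends the
number. -/
theorem flatMap_true_append_false_inj {l₁ l₂ r₁ r₂ : List Bool}
    (h : l₁.flatMap (fun b => [true, b]) ++ false :: r₁ =
      l₂.flatMap (fun b => [true, b]) ++ false :: r₂) : l₁ = l₂ ∧ r₁ = r₂ := by
  induction l₁ generalizing l₂ with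
  | nil => cases l₂ <;> simp_all
  | cons a l ih =>
    cases l₂ with
    | nil => simp at h
    | cons a' l' =>
      simp only [List.flatMap_cons, List.cons_append, List.nil_append, List.cons.injEq,
        true_and] at h
      obtain ⟨h₁, h₂⟩ := ih h.2
      simp [h.1, h₁, h₂]

theorem Nat.bits_injective : Function.Injective Nat.bits := by
  intro a b h
  exact Nat.digits_inj_iff.1 (by rw [Nat.digits_two_eq_bits, Nat.digits_two_eq_bits, h] :
    Nat.digits 2 a = Nat.digits 2 b)

theorem encodeNats_injective : Function.Injective encodeNats := by
  intro l₁ l₂ h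
  induction l₁ generalizing l₂ with
  | nil => cases l₂ <;> simp_all [encodeNats]
  | cons a l ih =>
    cases l₂ with
    | nil => simp [encodeNats] at h
    | cons a' l' =>
      obtain ⟨h₁, h₂⟩ := flatMap_true_append_false_inj h
      rw [Nat.bits_injective h₁, ih h₂]

theorem length_encodeNats_le {b : ℕ} {l : List ℕ} (h : ∀ x ∈ l, x < 2 ^ b) :
    (encodeNats l).length ≤ l.length * (2 * b + 1) := by
  induction l with
  | nil => simp [encodeNats]
  | cons a l ih =>
    have h₁ := ih fun x hx => h x (List.mem_cons_of_mem _ hx)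
    have h₂ : a.bits.length ≤ b := by
      rw [Nat.size_eq_bits_len]; exact Nat.size_le.2 (h a List.mem_cons_self)
    simp only [encodeNats, List.length_append, List.length_flatMap, List.length_cons,
      List.length_nil, List.map_const', List.sum_replicate, smul_eq_mul]
    nlinarith

/-- The inverse of `encodeNats`. -/
noncomputable def decodeNats : List Bool → List ℕ := Function.invFun encodeNats

theorem decodeNats_encodeNats (l : List ℕ) : decodeNats (encodeNats l) = l :=
  Function.leftInverse_invFun encodeNats_injective l

/-! ### Node programs -/

/-- A terminating program of a single node: in each round it sends one message to all its
neighbours, and continues depending on the messages received, indexed by the sender's identifier. -/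
inductive NodeProgram (α : Type) : Type
  | done (a : α) : NodeProgram α
  | round (msg : List ℕ) (next : (ℕ → List ℕ) → NodeProgram α) : NodeProgram α

namespace NodeProgram

variable {α β σ : Type}

/-- Sequential composition of programs. -/
def bind : NodeProgram α → (α → NodeProgram β) → NodeProgram β
  | done a, f => f a
  | round m k, f => round m fun ib => (k ib).bind f

/-- `loop msg upd n t s` runs the rounds `t, …, t + n - 1`; round `i` sends `msg i s` and replaces
the current value `s` by `upd i s` of the messages received. -/
def loop (msg : ℕ → σ → List ℕ) (upd : ℕ → σ → (ℕ → List ℕ) → σ) : ℕ → ℕ → σ → NodeProgram σ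
  | 0, _, s => done s
  | n + 1, t, s => round (msg t s) fun ib => loop msg upd n (t + 1) (upd t s ib)

/-- A message that is short enough: at most three numbers of at most `b` bits. -/
def Fits (b : ℕ) (m : List ℕ) : Prop := m.length ≤ 3 ∧ ∀ x ∈ m, x < 2 ^ b

theorem Fits.length_encodeNats_le {b : ℕ} {m : List ℕ} (h : Fits b m) :
    (encodeNats m).length ≤ 3 * (2 * b + 1) :=
  (_root_.length_encodeNats_le h.2).trans (Nat.mul_le_mul_right _ h.1)

/-! ### Lock-step semantics of node programs -/

section Semantics

variable {V : Type} (G : SimpleGraph V) (ident : V ↪ ℕ)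

/-- What the node `v` receives when each node `w` broadcasts `msg w`. -/
noncomputable def delivered (msg : V → List ℕ) (v : V) (i : ℕ) : List ℕ :=
  open Classical in
  if h : ∃ w, G.Adj v w ∧ ident w = i then msg h.choose else []

theorem delivered_of_adj (msg : V → List ℕ) {v w : V} (h : G.Adj v w) :
    delivered G ident msg v (ident w) = msg w := by
  have hex : ∃ x, G.Adj v x ∧ ident x = ident w := ⟨w, h, rfl⟩
  rw [delivered, dif_pos hex, ident.injective hex.choose_spec.2]

/-- When each node `v` runs the program `π v`, then all of them terminate after exactly `T` rounds,
with the results `res v`, and all messages on the way fit into `b` bits. -/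
def Runs (b : ℕ) : ℕ → (V → NodeProgram α) → (V → α) → Prop
  | 0, π, res => ∀ v, π v = done (res v)
  | T + 1, π, res => ∃ (msg : V → List ℕ) (next : V → (ℕ → List ℕ) → NodeProgram α),
      (∀ v, π v = round (msg v) (next v)) ∧ (∀ v, Fits b (msg v)) ∧
      Runs b T (fun v => next v (delivered G ident msg v)) res

variable {G ident} {b : ℕ}

theorem Runs.pure (res : V → α) : Runs G ident b 0 (fun v => done (res v)) res := fun _ => rfl

theorem Runs.step {T : ℕ} {msg : V → List ℕ} {next : V → (ℕ → List ℕ) → NodeProgram α}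
    {res : V → α} (hb : ∀ v, Fits b (msg v))
    (h : Runs G ident b T (fun v => next v (delivered G ident msg v)) res) :
    Runs G ident b (T + 1) (fun v => round (msg v) (next v)) res :=
  ⟨msg, next, fun _ => rfl, hb, h⟩

theorem Runs.ne_done {T : ℕ} {π : V → NodeProgram α} {res : V → α}
    (h : Runs G ident b (T + 1) π res) (v : V) (a : α) : π v ≠ done a := by
  obtain ⟨_, _, hπ, -⟩ := h
  rw [hπ]
  simp

theorem Runs.bind {T T' : ℕ} {π : V → NodeProgram α} {res : V → α}
    {f : V → α → NodeProgram β} {res' : V → β} (h : Runs G ident b T π res)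
    (h' : Runs G ident b T' (fun v => f v (res v)) res') :
    Runs G ident b (T + T') (fun v => (π v).bind (f v)) res' := by
  induction T generalizing π with
  | zero =>
    have hπ : π = fun v => done (res v) := funext h
    subst hπ
    simpa [NodeProgram.bind] using h'
  | succ T ih =>
    obtain ⟨msg, next, hπ, hb, hr⟩ := h
    obtain rfl : π = fun v => round (msg v) (next v) := funext hπ
    rw [Nat.succ_add]
    exact ⟨msg, fun v ib => (next v ib).bind (f v), fun v => rfl, hb, ih hr⟩

variable (G ident) in
/-- The values of a `loop` at all nodes, after `t` rounds. -/
noncomputable def loopState (msg : V → ℕ → σ → List ℕ) (upd : V → ℕ → σ → (ℕ → List ℕ) → σ)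
    (s : V → σ) : ℕ → V → σ
  | 0, v => s v
  | t + 1, v => upd v t (loopState msg upd s t v)
      (delivered G ident (fun w => msg w t (loopState msg upd s t w)) v)

theorem Runs.loop {msg : V → ℕ → σ → List ℕ} {upd : V → ℕ → σ → (ℕ → List ℕ) → σ}
    {s : V → σ} {n : ℕ}
    (hb : ∀ t < n, ∀ v, Fits b (msg v t (loopState G ident msg upd s t v))) :
    Runs G ident b n (fun v => loop (msg v) (upd v) n 0 (s v))
      (loopState G ident msg upd s n) := by
  suffices H : ∀ m t, t + m = n →
      Runs G ident b m (fun v => NodeProgram.loop (msg v) (upd v) m t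
        (loopState G ident msg upd s t v)) (loopState G ident msg upd s n) from H n 0 (by simp)
  intro m
  induction m with
  | zero => rintro t rfl v; rfl
  | succ m ih =>
    intro t ht
    exact ⟨_, _, fun v => rfl, hb t (by omega), ih (t + 1) (by omega)⟩

end Semantics

/-! ### Running programs with growing guesses -/

/-- The state of a node that runs the programs `P 0, P 1, …` until one of them succeeds. -/
structure SearchState (O : Type) where
  /-- the node's identifier -/
  me : ℕ
  /-- the identifiers of its neighbours -/
  nbrs : Finset ℕ
  /-- the number of the current program -/
  guess : ℕ
  /-- what is left of the current program -/
  prog : NodeProgram (Option O)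

variable {O : Type} (P : ℕ → ℕ → Finset ℕ → NodeProgram (Option O))

/-- The state in which `p` is left of the program number `k`; after a failure, the next program is
started. -/
def settle (me : ℕ) (nbrs : Finset ℕ) (k : ℕ) : NodeProgram (Option O) → SearchState O
  | done none => ⟨me, nbrs, k + 1, P (k + 1) me nbrs⟩
  | p => ⟨me, nbrs, k, p⟩

/-- The distributed algorithm that runs the programs `P 0, P 1, …` until one of them succeeds. -/
noncomputable def search : DistributedAlgorithm O where
  State := SearchState O
  init me nbrs := ⟨me, nbrs, 0, P 0 me nbrs⟩
  send s _ := match s.prog with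
    | round m _ => encodeNats m
    | done _ => []
  receive s ib := match s.prog with
    | round _ k => settle P s.me s.nbrs s.guess (k fun i => decodeNats (ib i))
    | done _ => s
  output s := match s.prog with
    | done (some o) => some o
    | _ => none

variable {V : Type} [Fintype V] {G : SimpleGraph V} {ident : V ↪ ℕ} {b : ℕ}

variable (G ident) in
/-- The identifiers of the neighbours of `v`. -/
noncomputable def nbrIds (v : V) : Finset ℕ :=
  open Classical in (Finset.univ.filter fun w => G.Adj v w).map ident

theorem mem_nbrIds {v : V} {i : ℕ} : i ∈ nbrIds G ident v ↔ ∃ w, G.Adj v w ∧ ident w = i := by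
  simp [nbrIds]

/-- All nodes are at the same point of the same program number, so one step of `Runs` is one round
of the network. -/
theorem stateAt_of_runs {T t k : ℕ} {π : V → NodeProgram (Option O)} {res : V → Option O}
    (hr : Runs G ident b T π res)
    (h : ∀ v, (search P).stateAt G ident t v =
      settle P (ident v) (nbrIds G ident v) k (π v)) :
    (∀ v, (search P).stateAt G ident (t + T) v =
      settle P (ident v) (nbrIds G ident v) k (done (res v))) ∧
    ∀ s, t ≤ s → s < t + T → ∀ v i,
      ((search P).outgoing ((search P).stateAt G ident s v) i).length ≤ 3 * (2 * b + 1) := by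
  induction T generalizing t π with
  | zero => exact ⟨fun v => by rw [Nat.add_zero, h, hr v], fun s h₁ h₂ => by omega⟩
  | succ T ih =>
    obtain ⟨msg, next, hπ, hb, hr⟩ := hr
    have hs : ∀ v, (search P).stateAt G ident t v =
        (⟨ident v, nbrIds G ident v, k, round (msg v) (next v)⟩ : SearchState O) := by
      intro v; rw [h, hπ]; rfl
    have hout : ∀ v i, (search P).outgoing ((search P).stateAt G ident t v) i =
        encodeNats (msg v) := by
      intro v i; rw [hs]; rfl
    have hin : ∀ v, (fun i => decodeNats
        ((search P).inbox G ident ((search P).stateAt G ident t) v i)) =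
          delivered G ident msg v := by
      intro v
      funext i
      unfold DistributedAlgorithm.inbox delivered
      split
      · rw [hout, decodeNats_encodeNats]
      -- The empty list is encoded by the empty string, so silence decodes to the default value `[]`
      -- of `delivered`.
      · exact decodeNats_encodeNats []
    obtain ⟨h₁, h₂⟩ := ih (t := t + 1) hr fun v => by
      rw [DistributedAlgorithm.stateAt, ← hin v, hs v]; rfl
    refine ⟨fun v => by rw [← h₁ v, Nat.add_right_comm, Nat.add_assoc], fun s hs₁ hs₂ v i => ?_⟩
    rcases hs₁.eq_or_lt with rfl | hlt
    · rw [hout]; exact (hb v).length_encodeNats_le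
    · exact h₂ s hlt (by omega) v i

/-- If the programs `P 0, …, P (K - 1)` fail and `P K` succeeds, then the search halts with the
results of the latter. -/
theorem search_spec {K : ℕ} {T : ℕ → ℕ} {out : V → O}
    (hstart : ∀ k, k < K → ∀ v, P (k + 1) (ident v) (nbrIds G ident v) ≠ done none)
    (hstart' : ∀ v, P 0 (ident v) (nbrIds G ident v) ≠ done none)
    (hfail : ∀ k < K, Runs G ident b (T k) (fun v => P k (ident v) (nbrIds G ident v))
      fun _ => none)
    (hok : Runs G ident b (T K) (fun v => P K (ident v) (nbrIds G ident v))
      fun v => some (out v)) {T' : ℕ} (hT : ∑ k ∈ Finset.range (K + 1), T k ≤ T') :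
    (search P).UsesBandwidth G ident (3 * (2 * b + 1)) ∧
      (search P).HaltsWithin G ident T' out := by
  -- `settle` skips a single failure only: a successor program that is `done none` from the outset
  -- would leave the search stuck, which `hstart` and `hstart'` exclude.
  have hset : ∀ k v p, p ≠ done none → settle P (ident v) (nbrIds G ident v) k p =
      ⟨ident v, nbrIds G ident v, k, p⟩ := by
    intro k v p hp
    match p, hp with
    | done (some o), _ => rfl
    | round _ _, _ => rfl
  have key : ∀ k ≤ K, (∀ v, (search P).stateAt G ident (∑ j ∈ Finset.range k, T j) v =
      settle P (ident v) (nbrIds G ident v) k (P k (ident v) (nbrIds G ident v))) ∧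
      ∀ s, s < ∑ j ∈ Finset.range k, T j → ∀ v i,
        ((search P).outgoing ((search P).stateAt G ident s v) i).length ≤ 3 * (2 * b + 1) := by
    intro k
    induction k with
    | zero =>
      refine fun _ => ⟨fun v => ?_, fun s hs => by simp at hs⟩
      rw [hset _ _ _ (hstart' v)]; rfl
    | succ k ih =>
      intro hk
      obtain ⟨h₁, h₂⟩ := ih (by omega)
      obtain ⟨h₃, h₄⟩ := stateAt_of_runs P (hfail k (by omega)) h₁
      rw [Finset.sum_range_succ]
      refine ⟨fun v => ?_, fun s hs v i => ?_⟩
      · rw [h₃, hset _ _ _ (hstart k (by omega) v)]; rfl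
      · by_cases h : s < ∑ j ∈ Finset.range k, T j
        · exact h₂ s h v i
        · exact h₄ s (by omega) hs v i
  obtain ⟨h₁, h₂⟩ := key K le_rfl
  obtain ⟨h₃, h₄⟩ := stateAt_of_runs P hok h₁
  rw [← Finset.sum_range_succ] at h₃ h₄
  have hfin : ∀ t, ∑ k ∈ Finset.range (K + 1), T k ≤ t → ∀ v,
      (search P).output ((search P).stateAt G ident t v) = some (out v) := by
    intro t ht
    induction t, ht using Nat.le_induction with
    | base => intro v; rw [h₃]; rfl
    | succ t _ ih =>
      intro v
      rw [DistributedAlgorithm.stateAt, if_pos (by rw [ih v]; rfl), ih v]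
  refine ⟨fun t u v _ => ?_, hfin T' hT⟩
  by_cases ht : t < ∑ k ∈ Finset.range (K + 1), T k
  · by_cases h : t < ∑ k ∈ Finset.range K, T k
    · exact h₂ t h u _
    · exact h₄ t (by omega) ht u _
  · rw [DistributedAlgorithm.outgoing, if_pos (by rw [hfin t (by omega) u]; rfl)]
    simp

end NodeProgram

/-! ### Rooted spanning trees and small cuts -/

/-- A rooted spanning tree of `G`, given by parents and levels. -/
structure ParentTree {V : Type} (G : SimpleGraph V) where
  /-- the root -/
  root : V
  /-- the parent of a vertex; the root is its own parent -/
  par : V → V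
  /-- the depth of a vertex -/
  lev : V → ℕ
  par_root : par root = root
  lev_root : lev root = 0
  adj_par : ∀ v, v ≠ root → G.Adj v (par v)
  lev_par : ∀ v, v ≠ root → lev (par v) + 1 = lev v

namespace ParentTree

variable {V : Type} {G : SimpleGraph V} (t : ParentTree G)

/-- `x` is in the subtree of `u`. -/
def Below (x u : V) : Prop := ∃ j, t.par^[j] x = u

/-- `x` and `y` are joined by an edge outside the tree. -/
def NonTree (x y : V) : Prop := G.Adj x y ∧ t.par x ≠ y ∧ t.par y ≠ x

/-- The edge from `v` to its parent. -/
def edge (v : V) : Sym2 V := s(v, t.par v)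

variable {t}

theorem NonTree.symm {x y : V} (h : t.NonTree x y) : t.NonTree y x := ⟨h.1.symm, h.2.2, h.2.1⟩

theorem eq_root_of_lev {v : V} (h : t.lev v = 0) : v = t.root := by
  by_contra hv
  have := t.lev_par v hv
  omega

theorem lev_ne_zero {v : V} (h : v ≠ t.root) : t.lev v ≠ 0 := fun h' => h (eq_root_of_lev h')

theorem lev_par_eq (v : V) : t.lev (t.par v) = t.lev v - 1 := by
  by_cases hv : v = t.root
  · simp [hv, t.par_root, t.lev_root]
  · have := t.lev_par v hv; omega

theorem lev_iterate (j : ℕ) (x : V) : t.lev (t.par^[j] x) = t.lev x - j := by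
  induction j generalizing x with
  | zero => rfl
  | succ j ih => rw [Function.iterate_succ_apply, ih, lev_par_eq]; omega

theorem iterate_eq_root {j : ℕ} {x : V} (h : t.lev x ≤ j) : t.par^[j] x = t.root :=
  eq_root_of_lev (by rw [lev_iterate]; omega)

theorem iterate_ne_root {v : V} {k : ℕ} (h : k < t.lev v) : t.par^[k] v ≠ t.root := by
  intro h'
  have h₁ := lev_iterate (t := t) k v
  rw [h', t.lev_root] at h₁
  omega

theorem below_iff {x u : V} :
    t.Below x u ↔ t.lev u ≤ t.lev x ∧ t.par^[t.lev x - t.lev u] x = u := by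
  refine ⟨?_, fun h => ⟨_, h.2⟩⟩
  rintro ⟨j, rfl⟩
  rw [lev_iterate]
  refine ⟨by omega, ?_⟩
  by_cases hj : j ≤ t.lev x
  · rw [Nat.sub_sub_self hj]
  · rw [iterate_eq_root (by omega), iterate_eq_root (by omega)]

theorem below_refl (x : V) : t.Below x x := ⟨0, rfl⟩

theorem below_iterate (x : V) (j : ℕ) : t.Below x (t.par^[j] x) := ⟨j, rfl⟩

theorem below_par (x : V) : t.Below x (t.par x) := ⟨1, rfl⟩

theorem below_root (x : V) : t.Below x t.root := ⟨t.lev x, iterate_eq_root le_rfl⟩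

theorem Below.trans {x y z : V} (h : t.Below x y) (h' : t.Below y z) : t.Below x z := by
  obtain ⟨i, rfl⟩ := h
  obtain ⟨j, rfl⟩ := h'
  exact ⟨j + i, Function.iterate_add_apply _ _ _ _⟩

theorem Below.lev_le {x y : V} (h : t.Below x y) : t.lev y ≤ t.lev x := (below_iff.1 h).1

theorem Below.eq_of_lev_le {x y : V} (h : t.Below x y) (hl : t.lev x ≤ t.lev y) : x = y := by
  have := (below_iff.1 h).2
  rwa [Nat.sub_eq_zero_of_le hl] at this

theorem Below.antisymm {x y : V} (h : t.Below x y) (h' : t.Below y x) : x = y :=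
  h.eq_of_lev_le h'.lev_le

/-- The ancestors of `x` form a chain, the orbit of `x` under the parent map. -/
theorem Below.total {x u w : V} (h : t.Below x u) (h' : t.Below x w) :
    t.Below u w ∨ t.Below w u := by
  obtain ⟨i, rfl⟩ := h
  obtain ⟨j, rfl⟩ := h'
  rcases le_total i j with hij | hij
  · exact .inl ⟨j - i, by rw [← Function.iterate_add_apply, Nat.sub_add_cancel hij]⟩
  · exact .inr ⟨i - j, by rw [← Function.iterate_add_apply, Nat.sub_add_cancel hij]⟩

theorem Below.eq_of_lev_eq {x u w : V} (h : t.Below x u) (h' : t.Below x w)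
    (hl : t.lev u = t.lev w) : u = w := by
  rcases h.total h' with h | h
  · exact h.eq_of_lev_le hl.le
  · exact (h.eq_of_lev_le hl.ge).symm

theorem Below.par_below {x u : V} (h : t.Below x u) (hne : x ≠ u) : t.Below (t.par x) u := by
  obtain ⟨j, rfl⟩ := h
  cases j with
  | zero => exact absurd rfl hne
  | succ j => exact ⟨j, (Function.iterate_succ_apply _ _ _).symm⟩

theorem not_below_par {u : V} (hu : u ≠ t.root) : ¬ t.Below (t.par u) u := by
  intro h
  have h₁ := h.lev_le
  have h₂ := t.lev_par u hu
  omega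

theorem ne_root_of_not_below {y u : V} (h : ¬ t.Below y u) : u ≠ t.root := by
  rintro rfl; exact h (below_root y)

/-- An edge that leaves the subtree of `u` is the edge above `u` or outside the tree. -/
theorem eq_or_nonTree_of_leaves {x y u : V} (ha : G.Adj x y) (hx : t.Below x u)
    (hy : ¬ t.Below y u) : (x = u ∧ y = t.par u) ∨ t.NonTree x y := by
  by_cases h₁ : t.par x = y
  · left
    have : x = u := by
      by_contra hne
      exact hy (h₁ ▸ hx.par_below hne)
    exact ⟨this, by rw [← h₁, this]⟩
  · refine .inr ⟨ha, h₁, fun h₂ => hy ?_⟩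
    exact (h₂ ▸ below_par y : t.Below y x).trans hx

/-- The subtree of `u` consists of `u` and the subtrees of its children. -/
theorem below_iff_eq_or_child {x u : V} :
    t.Below x u ↔ x = u ∨ ∃ c, (G.Adj u c ∧ t.par c = u) ∧ t.Below x c := by
  constructor
  · rintro ⟨j, hj⟩
    induction j generalizing u with
    | zero => exact .inl hj
    | succ j ih =>
      rw [Function.iterate_succ_apply'] at hj
      by_cases hr : t.par^[j] x = t.root
      · rw [hr, t.par_root] at hj
        exact ih (hr.trans hj)
      · exact .inr ⟨_, ⟨hj ▸ (t.adj_par _ hr).symm, hj⟩, below_iterate x j⟩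
  · rintro (rfl | ⟨c, ⟨-, rfl⟩, hc⟩)
    · exact below_refl _
    · exact hc.trans (below_par c)

theorem lev_child {u c : V} (ha : G.Adj u c) (hp : t.par c = u) : t.lev c = t.lev u + 1 := by
  have hc : c ≠ t.root := by
    rintro rfl
    rw [t.par_root] at hp
    exact G.ne_of_adj ha hp.symm
  rw [← hp, t.lev_par c hc]

theorem edge_injective {v w : V} (hv : v ≠ t.root) (hw : w ≠ t.root)
    (h : t.edge v = t.edge w) : v = w := by
  rcases Sym2.eq_iff.1 h with h | h
  · exact h.1
  · have h₁ := t.lev_par v hv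
    have h₂ := t.lev_par w hw
    rw [h.2] at h₁
    rw [← h.1] at h₂
    omega

theorem NonTree.ne_edge {x y v : V} (h : t.NonTree x y) : s(x, y) ≠ t.edge v := by
  intro he
  rcases Sym2.eq_iff.1 he with ⟨rfl, rfl⟩ | ⟨rfl, rfl⟩
  · exact h.2.1 rfl
  · exact h.2.2 rfl

/-! ### Constructing cuts from a spanning tree -/

section Cuts

variable [Fintype V]

open Classical in
variable (t) in
/-- The edges outside the tree that leave the subtree of `u`, oriented outwards. -/
noncomputable def cov (u : V) : Finset (V × V) :=
  Finset.univ.filter fun e => t.Below e.1 u ∧ ¬ t.Below e.2 u ∧ t.NonTree e.1 e.2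

theorem mem_cov {u x y : V} :
    (x, y) ∈ t.cov u ↔ t.Below x u ∧ ¬ t.Below y u ∧ t.NonTree x y := by
  simp [cov]

theorem mem_cutSet {A : Finset V} {x y : V} :
    s(x, y) ∈ G.cutSet A ↔ G.Adj x y ∧ ¬ (x ∈ A ↔ y ∈ A) := by
  simp only [SimpleGraph.cutSet, Finset.mem_filter, Finset.mem_univ, true_and,
    SimpleGraph.mem_edgeSet]
  refine and_congr_right fun _ => ⟨?_, fun h => ?_⟩
  · rintro ⟨u, hu, v, hv, h⟩
    rcases Sym2.eq_iff.1 h with ⟨rfl, rfl⟩ | ⟨rfl, rfl⟩ <;> tauto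
  · by_cases hx : x ∈ A
    · exact ⟨x, hx, y, by tauto, rfl⟩
    · exact ⟨y, by tauto, x, hx, Sym2.eq_swap⟩

/-- `F` is the cut-set of a partition into two nonempty parts. -/
def IsCut (G : SimpleGraph V) (F : Finset (Sym2 V)) : Prop :=
  ∃ A : Finset V, A.Nonempty ∧ A ≠ Finset.univ ∧ F = G.cutSet A

open Classical in
theorem isCut_of_forall {F : Finset (Sym2 V)} {p : V → Prop} {a b : V} (ha : p a) (hb : ¬ p b)
    (h : ∀ x y, p x → ¬ p y → G.Adj x y → s(x, y) ∈ F)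
    (h' : ∀ e ∈ F, ∃ x y, e = s(x, y) ∧ p x ∧ ¬ p y ∧ G.Adj x y) : IsCut G F := by
  refine ⟨Finset.univ.filter p, ⟨a, by simpa using ha⟩, fun he => hb ?_, ?_⟩
  · simpa using he.ge (Finset.mem_univ b)
  · ext e
    constructor
    · intro he
      obtain ⟨x, y, rfl, hx, hy, hxy⟩ := h' e he
      rw [mem_cutSet]
      simp [hx, hy, hxy]
    · induction e with
      | _ x y =>
      rw [mem_cutSet]
      rintro ⟨hxy, hne⟩
      simp only [Finset.mem_filter, Finset.mem_univ, true_and] at hne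
      by_cases hx : p x
      · exact h x y hx (by tauto) hxy
      · rw [Sym2.eq_swap]; exact h y x (by tauto) hx hxy.symm

open Classical in
/-- A subtree that is left by a single non-tree edge gives a cut of size two. -/
theorem isCut_of_cov_singleton {a x y : V} (h : t.cov a = {(x, y)}) :
    IsCut G {t.edge a, s(x, y)} ∧ ({t.edge a, s(x, y)} : Finset (Sym2 V)).card = 2 := by
  have hm : (x, y) ∈ t.cov a := by simp [h]
  obtain ⟨hx, hy, hn⟩ := mem_cov.1 hm
  have ha := ne_root_of_not_below hy
  refine ⟨isCut_of_forall (p := fun z => t.Below z a) hx hy ?_ ?_, Finset.card_pair ?_⟩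
  · intro z w hz hw hzw
    rcases eq_or_nonTree_of_leaves hzw hz hw with ⟨rfl, rfl⟩ | hn
    · simp [edge]
    · have hzw : (z, w) ∈ t.cov a := mem_cov.2 ⟨hz, hw, hn⟩
      rw [h, Finset.mem_singleton] at hzw
      simp_all
  · intro e he
    rw [Finset.mem_insert, Finset.mem_singleton] at he
    rcases he with rfl | rfl
    · exact ⟨_, _, rfl, below_refl a, not_below_par ha, t.adj_par a ha⟩
    · exact ⟨_, _, rfl, hx, hy, hn.1⟩
  · exact hn.ne_edge.symm

open Classical in
/-- Two tree edges, one above the other, covered by the same non-tree edges form a cut. -/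
theorem isCut_of_below {u a : V} (hu : u ≠ t.root) (ha : a ≠ t.root) (hne : u ≠ a)
    (hua : t.Below u a) (h : t.cov u = t.cov a) :
    IsCut G {t.edge u, t.edge a} ∧ ({t.edge u, t.edge a} : Finset (Sym2 V)).card = 2 := by
  have hau : ¬ t.Below a u := fun h' => hne (hua.antisymm h')
  refine ⟨isCut_of_forall (p := fun z => t.Below z a ∧ ¬ t.Below z u)
    (a := a) (b := u) ⟨below_refl a, hau⟩ (by simp [below_refl]) ?_ ?_,
    Finset.card_pair fun he => hne (edge_injective hu ha he)⟩
  · rintro z w ⟨hz₁, hz₂⟩ hw hzw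
    by_cases hwa : t.Below w a
    · have hwu : t.Below w u := by tauto
      rcases eq_or_nonTree_of_leaves hzw.symm hwu hz₂ with ⟨rfl, rfl⟩ | hn
      · simp [edge, Sym2.eq_swap]
      · have hm : (w, z) ∈ t.cov u := mem_cov.2 ⟨hwu, hz₂, hn⟩
        rw [h] at hm
        exact absurd hz₁ (mem_cov.1 hm).2.1
    · rcases eq_or_nonTree_of_leaves hzw hz₁ hwa with ⟨rfl, rfl⟩ | hn
      · simp [edge]
      · have hm : (z, w) ∈ t.cov a := mem_cov.2 ⟨hz₁, hwa, hn⟩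
        rw [← h] at hm
        exact absurd (mem_cov.1 hm).1 hz₂
  · intro e he
    rw [Finset.mem_insert, Finset.mem_singleton] at he
    rcases he with rfl | rfl
    · exact ⟨t.par u, u, Sym2.eq_swap, ⟨hua.par_below hne, not_below_par hu⟩,
        by simp [below_refl], (t.adj_par u hu).symm⟩
    · exact ⟨a, t.par a, rfl, ⟨below_refl a, hau⟩, fun h' => not_below_par ha h'.1,
        t.adj_par a ha⟩

open Classical in
/-- Two tree edges with disjoint subtrees, covered by the same non-tree edges, form a cut. -/
theorem isCut_of_disjoint {u w : V} (hu : u ≠ t.root) (hw : w ≠ t.root)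
    (huw : ¬ t.Below u w) (hwu : ¬ t.Below w u)
    (h₁ : ∀ x y, (x, y) ∈ t.cov u → t.Below y w) (h₂ : ∀ x y, (x, y) ∈ t.cov w → t.Below y u) :
    IsCut G {t.edge u, t.edge w} ∧ ({t.edge u, t.edge w} : Finset (Sym2 V)).card = 2 := by
  refine ⟨isCut_of_forall (p := fun z => t.Below z u ∨ t.Below z w)
    (a := u) (b := t.root) (.inl (below_refl u)) ?_ ?_ ?_,
    Finset.card_pair fun he => huw (edge_injective hu hw he ▸ below_refl u)⟩
  · rintro (h | h)
    · exact hu (h.antisymm (below_root u)).symm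
    · exact hw (h.antisymm (below_root w)).symm
  · rintro x y (hx | hx) hy hxy
    · rcases eq_or_nonTree_of_leaves hxy hx (fun h => hy (.inl h)) with ⟨rfl, rfl⟩ | hn
      · simp [edge]
      · exact absurd (.inr (h₁ x y (mem_cov.2 ⟨hx, fun h => hy (.inl h), hn⟩))) hy
    · rcases eq_or_nonTree_of_leaves hxy hx (fun h => hy (.inr h)) with ⟨rfl, rfl⟩ | hn
      · simp [edge]
      · exact absurd (.inl (h₂ x y (mem_cov.2 ⟨hx, fun h => hy (.inr h), hn⟩))) hy
  · intro e he
    rw [Finset.mem_insert, Finset.mem_singleton] at he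
    rcases he with rfl | rfl
    · refine ⟨u, t.par u, rfl, .inl (below_refl u), ?_, t.adj_par u hu⟩
      rintro (h | h)
      · exact not_below_par hu h
      · exact huw ((below_par u).trans h)
    · refine ⟨w, t.par w, rfl, .inr (below_refl w), ?_, t.adj_par w hw⟩
      rintro (h | h)
      · exact hwu ((below_par w).trans h)
      · exact not_below_par hw h

-- Subtrees of incomparable vertices are disjoint, so an edge from the first to the second, read
-- backwards, leaves the second.
open Classical in
theorem image_swap_cov_subset {u w : V} (huw : ¬ t.Below u w) (hwu : ¬ t.Below w u)
    (h : ∀ x y, (x, y) ∈ t.cov u → t.Below y w) : (t.cov u).image Prod.swap ⊆ t.cov w := by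
  intro e he
  obtain ⟨⟨x, y⟩, hm, rfl⟩ := Finset.mem_image.1 he
  obtain ⟨hx, hy, hn⟩ := mem_cov.1 hm
  refine mem_cov.2 ⟨h x y hm, fun hxw => ?_, hn.symm⟩
  rcases hx.total hxw with h | h
  · exact huw h
  · exact hwu h

theorem card_cov_le {u w : V} (huw : ¬ t.Below u w) (hwu : ¬ t.Below w u)
    (h : ∀ x y, (x, y) ∈ t.cov u → t.Below y w) : (t.cov u).card ≤ (t.cov w).card := by
  classical
  rw [← Finset.card_image_of_injective (t.cov u) Prod.swap_injective]
  exact Finset.card_le_card (image_swap_cov_subset huw hwu h)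

/-- Reversal embeds `cov u` into `cov w`; equal cardinalities make it a bijection. A one-sided test
at `u` together with a comparison of counts therefore suffices. -/
theorem below_of_card_cov_eq {u w : V} (huw : ¬ t.Below u w) (hwu : ¬ t.Below w u)
    (h : ∀ x y, (x, y) ∈ t.cov u → t.Below y w) (hc : (t.cov u).card = (t.cov w).card) :
    ∀ x y, (x, y) ∈ t.cov w → t.Below y u := by
  classical
  intro x y hxy
  rw [← Finset.eq_of_subset_of_card_le (image_swap_cov_subset huw hwu h)
    (by rw [Finset.card_image_of_injective _ Prod.swap_injective, hc])] at hxy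
  obtain ⟨⟨x', y'⟩, hm, he⟩ := Finset.mem_image.1 hxy
  simp only [Prod.swap_prod_mk, Prod.mk.injEq] at he
  rw [← he.2]
  exact (mem_cov.1 hm).1

/-! ### Every small cut has one of these shapes -/

variable {B : Finset V}

theorem edge_mem_cutSet_iff {v : V} :
    t.edge v ∈ G.cutSet B ↔ ¬ (v ∈ B ↔ t.par v ∈ B) := by
  rw [edge, mem_cutSet]
  refine ⟨And.right, fun h => ⟨t.adj_par v ?_, h⟩⟩
  rintro rfl
  exact h (by rw [t.par_root])

theorem ne_root_of_edge_mem {v : V} (h : t.edge v ∈ G.cutSet B) : v ≠ t.root := by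
  rintro rfl
  exact edge_mem_cutSet_iff.1 h (by rw [t.par_root])

/-- Climbing from `x` to `z` changes sides only along tree edges of the cut. The edge above `z` is
not on this path, hence the exception `v = z`. -/
theorem mem_iff_of_below {x z : V} (hxz : t.Below x z)
    (h : ∀ v, t.edge v ∈ G.cutSet B → t.Below x v → t.Below v z → v = z) :
    x ∈ B ↔ z ∈ B := by
  obtain ⟨j, hj⟩ := hxz
  induction j generalizing x with
  | zero => rw [← hj]; rfl
  | succ j ih =>
    by_cases hxz : x = z
    · rw [hxz]
    · have hC : x ∈ B ↔ t.par x ∈ B := by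
        by_contra hc
        exact hxz (h x (edge_mem_cutSet_iff.2 hc) (below_refl x) ⟨_, hj⟩)
      rw [hC]
      exact ih (fun v hv h₁ h₂ => h v hv ((below_par x).trans h₁) h₂) hj

theorem NonTree.mem_iff {F : Finset (Sym2 V)} (hF : F = G.cutSet B)
    (hFt : ∀ e ∈ F, ∃ v, e = t.edge v) {x y : V} (h : t.NonTree x y) : x ∈ B ↔ y ∈ B := by
  by_contra hne
  obtain ⟨v, hv⟩ := hFt s(x, y) (hF ▸ mem_cutSet.2 ⟨h.1, hne⟩)
  exact h.ne_edge hv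

theorem exists_edge_mem_cutSet (h₁ : B.Nonempty) (h₂ : B ≠ Finset.univ) :
    ∃ v, t.edge v ∈ G.cutSet B := by
  by_contra! hne
  have key : ∀ x, x ∈ B ↔ t.root ∈ B := fun x =>
    mem_iff_of_below (below_root x) fun v hv => absurd hv (hne v)
  obtain ⟨b, hb⟩ := h₁
  exact h₂ (Finset.eq_univ_of_forall fun x => (key x).2 ((key b).1 hb))

/-- If every subtree is left by a non-tree edge, then there is no cut of size less than two. -/
theorem two_le_card_cutSet (h : ∀ u, u ≠ t.root → (t.cov u).Nonempty)
    (h₁ : B.Nonempty) (h₂ : B ≠ Finset.univ) : 2 ≤ (G.cutSet B).card := by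
  obtain ⟨u, hu⟩ := exists_edge_mem_cutSet (t := t) h₁ h₂
  have hr := ne_root_of_edge_mem hu
  by_contra! hlt
  have hall : ∀ e ∈ G.cutSet B, e = t.edge u := fun e he =>
    Finset.card_le_one.1 (by omega) e he _ hu
  have hun : ∀ v, t.edge v ∈ G.cutSet B → v = u := fun v hv =>
    edge_injective (ne_root_of_edge_mem hv) hr (hall _ hv)
  -- With `u` carrying the only cut edge, a covering edge `xy` connects the side of `u` to the side
  -- of the root, which is that of `t.par u`: a contradiction.
  obtain ⟨⟨x, y⟩, hxy⟩ := h u hr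
  obtain ⟨hx, hy, hn⟩ := mem_cov.1 hxy
  have e₁ : x ∈ B ↔ u ∈ B := mem_iff_of_below hx fun v hv _ _ => hun v hv
  have e₂ : y ∈ B ↔ t.root ∈ B := mem_iff_of_below (below_root y) fun v hv hyv _ =>
    absurd (hun v hv ▸ hyv) hy
  have e₃ : t.par u ∈ B ↔ t.root ∈ B := mem_iff_of_below (below_root _) fun v hv hyv _ =>
    absurd (hun v hv ▸ hyv) (not_below_par hr)
  have e₄ : x ∈ B ↔ y ∈ B := hn.mem_iff rfl fun e he => ⟨u, hall e he⟩
  exact edge_mem_cutSet_iff.1 hu (e₁.symm.trans (e₄.trans (e₂.trans e₃.symm)))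

/-- With a single tree edge in the cut, the two sides are the subtree of `a` and its complement.
Every edge of `cov a` is then cut and must be `f`. -/
theorem cov_eq_singleton_of_cut {a : V} {f : Sym2 V} (ha : t.edge a ∈ G.cutSet B)
    (hun : ∀ v, t.edge v ∈ G.cutSet B → v = a) (hf : f ∈ G.cutSet B) (hne : f ≠ t.edge a)
    (hall : ∀ e ∈ G.cutSet B, e = t.edge a ∨ e = f) :
    ∃ x y, t.cov a = {(x, y)} ∧ f = s(x, y) := by
  have hr := ne_root_of_edge_mem ha
  have hin : ∀ x, t.Below x a → (x ∈ B ↔ a ∈ B) := fun x hx =>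
    mem_iff_of_below hx fun v hv _ _ => hun v hv
  have hout : ∀ y, ¬ t.Below y a → (y ∈ B ↔ t.root ∈ B) := fun y hy =>
    mem_iff_of_below (below_root y) fun v hv hyv _ => absurd (hun v hv ▸ hyv) hy
  have hpar := hout _ (not_below_par hr)
  have hcross := edge_mem_cutSet_iff.1 ha
  have hcov : ∀ x y, (x, y) ∈ t.cov a → s(x, y) = f := by
    intro x y hxy
    obtain ⟨hx, hy, hn⟩ := mem_cov.1 hxy
    have h₁ := hin x hx
    have h₂ := hout y hy
    exact (hall s(x, y) (mem_cutSet.2 ⟨hn.1, fun h =>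
      hcross (h₁.symm.trans (h.trans (h₂.trans hpar.symm)))⟩)).resolve_left hn.ne_edge
  obtain ⟨x, y, hx, hy, hadj, rfl⟩ :
      ∃ x y, t.Below x a ∧ ¬ t.Below y a ∧ G.Adj x y ∧ f = s(x, y) := by
    induction f with
    | _ x y =>
    obtain ⟨hadj, hxy⟩ := mem_cutSet.1 hf
    by_cases hx : t.Below x a <;> by_cases hy : t.Below y a
    · exact absurd ((hin x hx).trans (hin y hy).symm) hxy
    · exact ⟨x, y, hx, hy, hadj, rfl⟩
    · exact ⟨y, x, hy, hx, hadj.symm, Sym2.eq_swap⟩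
    · exact absurd ((hout x hx).trans (hout y hy).symm) hxy
  refine ⟨x, y, Finset.eq_singleton_iff_unique_mem.2 ⟨?_, ?_⟩, rfl⟩
  · rcases eq_or_nonTree_of_leaves hadj hx hy with ⟨rfl, rfl⟩ | hn
    · exact absurd rfl hne
    · exact mem_cov.2 ⟨hx, hy, hn⟩
  · rintro ⟨x', y'⟩ hm
    rcases Sym2.eq_iff.1 (hcov x' y' hm) with ⟨rfl, rfl⟩ | ⟨rfl, rfl⟩
    · rfl
    · exact absurd (mem_cov.1 hm).1 hy

-- The side is constant on the subtree of `u`, on the rest of the subtree of `w`, and outside the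
-- latter. The middle region is opposite to both others, and no non-tree edge is cut; so none joins
-- the middle to another region.
open Classical in
theorem cov_eq_of_cut {u w : V} (hF : G.cutSet B = {t.edge u, t.edge w}) (hne : u ≠ w)
    (huw : t.Below u w) : t.cov u = t.cov w := by
  have hu : t.edge u ∈ G.cutSet B := by simp [hF]
  have hw : t.edge w ∈ G.cutSet B := by simp [hF]
  have hur := ne_root_of_edge_mem hu
  have hwr := ne_root_of_edge_mem hw
  have hun : ∀ v, t.edge v ∈ G.cutSet B → v = u ∨ v = w := by
    intro v hv
    have hv' := hv
    rw [hF, Finset.mem_insert, Finset.mem_singleton] at hv'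
    exact hv'.imp (edge_injective (ne_root_of_edge_mem hv) hur)
      (edge_injective (ne_root_of_edge_mem hv) hwr)
  have hnt : ∀ {x y}, t.NonTree x y → (x ∈ B ↔ y ∈ B) := fun h =>
    h.mem_iff hF.symm fun e he => by
      rw [Finset.mem_insert, Finset.mem_singleton] at he
      exact he.elim (fun h => ⟨u, h⟩) fun h => ⟨w, h⟩
  have hwu : ¬ t.Below w u := fun h => hne (huw.antisymm h)
  have h₁ : ∀ x, t.Below x u → (x ∈ B ↔ u ∈ B) := fun x hx =>
    mem_iff_of_below hx fun v hv _ hvu => (hun v hv).resolve_right fun h => hwu (h ▸ hvu)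
  have h₂ : ∀ x, t.Below x w → ¬ t.Below x u → (x ∈ B ↔ w ∈ B) := fun x hx hxu =>
    mem_iff_of_below hx fun v hv hxv _ => (hun v hv).resolve_left fun h => hxu (h ▸ hxv)
  have h₃ : ∀ x, ¬ t.Below x w → (x ∈ B ↔ t.root ∈ B) := fun x hx =>
    mem_iff_of_below (below_root x) fun v hv hxv _ => by
      rcases hun v hv with rfl | rfl
      · exact absurd (hxv.trans huw) hx
      · exact absurd hxv hx
  have hcu := edge_mem_cutSet_iff.1 hu
  have hcw := edge_mem_cutSet_iff.1 hw
  have e₁ := h₂ _ (huw.par_below hne) (not_below_par hur)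
  have e₂ := h₃ _ (not_below_par hwr)
  ext ⟨x, y⟩
  rw [mem_cov, mem_cov]
  constructor
  · rintro ⟨hx, hy, hn⟩
    refine ⟨hx.trans huw, fun hyw => ?_, hn⟩
    exact hcu ((h₁ x hx).symm.trans ((hnt hn).trans ((h₂ y hyw hy).trans e₁.symm)))
  · rintro ⟨hx, hy, hn⟩
    refine ⟨?_, fun h => hy (h.trans huw), hn⟩
    by_contra hxu
    exact hcw ((h₂ x hx hxu).symm.trans ((hnt hn).trans ((h₃ y hy).trans e₂.symm)))

-- Outside both subtrees everything lies on the root's side, opposite to the subtree of `u`. An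
-- uncut edge leaving the latter can only end below `w`.
open Classical in
theorem below_of_cut {u w : V} (hF : G.cutSet B = {t.edge u, t.edge w})
    (huw : ¬ t.Below u w) (hwu : ¬ t.Below w u) {x y : V} (hxy : (x, y) ∈ t.cov u) :
    t.Below y w := by
  have hu : t.edge u ∈ G.cutSet B := by simp [hF]
  have hw : t.edge w ∈ G.cutSet B := by simp [hF]
  have hur := ne_root_of_edge_mem hu
  have hwr := ne_root_of_edge_mem hw
  have hun : ∀ v, t.edge v ∈ G.cutSet B → v = u ∨ v = w := by
    intro v hv
    have hv' := hv
    rw [hF, Finset.mem_insert, Finset.mem_singleton] at hv'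
    exact hv'.imp (edge_injective (ne_root_of_edge_mem hv) hur)
      (edge_injective (ne_root_of_edge_mem hv) hwr)
  obtain ⟨hx, hy, hn⟩ := mem_cov.1 hxy
  have e₁ : x ∈ B ↔ y ∈ B := hn.mem_iff hF.symm fun e he => by
    rw [Finset.mem_insert, Finset.mem_singleton] at he
    exact he.elim (fun h => ⟨u, h⟩) fun h => ⟨w, h⟩
  have e₂ : x ∈ B ↔ u ∈ B := mem_iff_of_below hx fun v hv _ hvu =>
    (hun v hv).resolve_right fun h => hwu (h ▸ hvu)
  have h₃ : ∀ z, ¬ t.Below z u → ¬ t.Below z w → (z ∈ B ↔ t.root ∈ B) := fun z hzu hzw =>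
    mem_iff_of_below (below_root z) fun v hv hzv _ => by
      rcases hun v hv with rfl | rfl
      · exact absurd hzv hzu
      · exact absurd hzv hzw
  have e₃ := h₃ _ (not_below_par hur) fun h => huw ((below_par u).trans h)
  by_contra hyw
  exact edge_mem_cutSet_iff.1 hu (e₂.symm.trans (e₁.trans ((h₃ y hy hyw).trans e₃.symm)))

open Classical in
/-- The shapes of the cuts of size two. -/
theorem cut_cases {F : Finset (Sym2 V)} (hF : IsCut G F) (hc : F.card = 2) :
    (∃ a x y, t.cov a = {(x, y)} ∧ F = {t.edge a, s(x, y)}) ∨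
    (∃ u w, u ≠ t.root ∧ w ≠ t.root ∧ u ≠ w ∧ t.Below u w ∧ t.cov u = t.cov w ∧
      F = {t.edge u, t.edge w}) ∨
    ∃ u w, u ≠ t.root ∧ w ≠ t.root ∧ ¬ t.Below u w ∧ ¬ t.Below w u ∧ t.lev w ≤ t.lev u ∧
      (∀ x y, (x, y) ∈ t.cov u → t.Below y w) ∧ (t.cov u).card = (t.cov w).card ∧
      F = {t.edge u, t.edge w} := by
  obtain ⟨B, h₁, h₂, rfl⟩ := hF
  obtain ⟨a, ha⟩ := exists_edge_mem_cutSet (t := t) h₁ h₂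
  obtain ⟨f, hfa, hf⟩ : ∃ f, f ≠ t.edge a ∧ G.cutSet B = {t.edge a, f} := by
    obtain ⟨e, f, hef, h⟩ := Finset.card_eq_two.1 hc
    rw [h, Finset.mem_insert, Finset.mem_singleton] at ha
    rcases ha with ha | ha
    · exact ⟨f, ha ▸ hef.symm, ha ▸ h⟩
    · exact ⟨e, ha ▸ hef, by rw [h, ha, Finset.pair_comm]⟩
  by_cases hw : ∃ w, w ≠ a ∧ t.edge w ∈ G.cutSet B
  · obtain ⟨w, hwa, hw⟩ := hw
    have har := ne_root_of_edge_mem ha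
    have hwr := ne_root_of_edge_mem hw
    obtain rfl : t.edge w = f := by
      have := hw
      rw [hf, Finset.mem_insert, Finset.mem_singleton] at this
      exact this.resolve_left fun h => hwa (edge_injective hwr har h)
    have hf' : G.cutSet B = {t.edge w, t.edge a} := by rw [hf, Finset.pair_comm]
    right
    by_cases haw : t.Below a w
    · exact .inl ⟨a, w, har, hwr, hwa.symm, haw, cov_eq_of_cut hf hwa.symm haw, hf⟩
    by_cases hwa' : t.Below w a
    · exact .inl ⟨w, a, hwr, har, hwa, hwa', cov_eq_of_cut hf' hwa hwa', hf'⟩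
    right
    have b₁ : ∀ x y, (x, y) ∈ t.cov a → t.Below y w := fun x y => below_of_cut hf haw hwa'
    have b₂ : ∀ x y, (x, y) ∈ t.cov w → t.Below y a := fun x y => below_of_cut hf' hwa' haw
    have hcard := le_antisymm (card_cov_le haw hwa' b₁) (card_cov_le hwa' haw b₂)
    -- The deeper vertex takes the role of `u`: it will detect the pair, as its labels reach up to
    -- the level of the other one.
    rcases le_total (t.lev w) (t.lev a) with hl | hl
    · exact ⟨a, w, har, hwr, haw, hwa', hl, b₁, hcard, hf⟩
    · exact ⟨w, a, hwr, har, hwa', haw, hl, b₂, hcard.symm, hf'⟩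
  · push Not at hw
    obtain ⟨x, y, h, rfl⟩ := cov_eq_singleton_of_cut (f := f) ha
      (fun v hv => by_contra fun hne => hw v hne hv) (by simp [hf]) hfa
      (fun e he => by simpa [hf] using he)
    exact .inl ⟨a, x, y, h, hf⟩

/-- A subtree that is left by no non-tree edge yields a bridge. -/
theorem cov_nonempty_of_isMinCut {F : Finset (Sym2 V)} (hF : G.IsMinCut F) (hc : F.card = 2)
    {u : V} (hu : u ≠ t.root) : (t.cov u).Nonempty := by
  classical
  by_contra hne
  rw [Finset.not_nonempty_iff_eq_empty] at hne
  obtain ⟨A, h₁, h₂, h₃⟩ : IsCut G {t.edge u} := by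
    refine isCut_of_forall (p := fun z => t.Below z u) (below_refl u) (not_below_par hu) ?_ ?_
    · intro x y hx hy hxy
      rcases eq_or_nonTree_of_leaves hxy hx hy with ⟨rfl, rfl⟩ | hn
      · simp [edge]
      · have hm : (x, y) ∈ t.cov u := mem_cov.2 ⟨hx, hy, hn⟩
        simp [hne] at hm
    · intro e he
      rw [Finset.mem_singleton] at he
      exact ⟨u, t.par u, he, below_refl u, not_below_par hu, t.adj_par u hu⟩
  have := hF.2 A h₁ h₂
  rw [hc, ← h₃, Finset.card_singleton] at this
  omega

theorem isMinCut_of_isCut {F : Finset (Sym2 V)} (h : ∀ u, u ≠ t.root → (t.cov u).Nonempty)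
    (hF : IsCut G F) (hc : F.card = 2) : G.IsMinCut F :=
  ⟨hF, fun _ h₁ h₂ => hc ▸ two_le_card_cutSet h h₁ h₂⟩

end Cuts

end ParentTree

/-! ### Aggregation over subtrees -/

namespace ParentTree

variable {V : Type} {G : SimpleGraph V} {t : ParentTree G} {I : V → ℕ}

variable (t I) in
/-- The value `I` (plus one) of the ancestor of `y` at level `i`, and `0` if there is none. -/
def label (y : V) (i : ℕ) : ℕ :=
  if i ≤ t.lev y then I (t.par^[t.lev y - i] y) + 1 else 0

theorem label_zero (y : V) : t.label I y 0 = I t.root + 1 := by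
  rw [label, if_pos (Nat.zero_le _), iterate_eq_root (by omega)]

theorem label_of_below {y a : V} (h : t.Below y a) : t.label I y (t.lev a) = I a + 1 := by
  rw [below_iff] at h
  rw [label, if_pos h.1, h.2]

theorem label_eq_iff (hI : Function.Injective I) {y a : V} :
    t.label I y (t.lev a) = I a + 1 ↔ t.Below y a := by
  refine ⟨fun h => ?_, label_of_below⟩
  rw [label] at h
  split at h
  · exact below_iff.2 ⟨‹_›, hI (by omega)⟩
  · omega

theorem label_eq_zero_or (y : V) (i : ℕ) : t.label I y i = 0 ∨ ∃ w, t.label I y i = I w + 1 := by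
  rw [label]
  split
  · exact .inr ⟨_, rfl⟩
  · exact .inl rfl

theorem label_lt {b : ℕ} (hb : ∀ v, I v + 1 < 2 ^ b) (y : V) (i : ℕ) :
    t.label I y i < 2 ^ b := by
  rcases label_eq_zero_or (t := t) (I := I) y i with h | ⟨w, h⟩
  · rw [h]; positivity
  · rw [h]; exact hb w

theorem eq_of_label_eq (hI : Function.Injective I) {y w : V} {i : ℕ}
    (h : t.label I y i = I w + 1) : t.lev w = i ∧ t.Below y w := by
  rw [label] at h
  split at h
  · obtain rfl : t.par^[t.lev y - i] y = w := hI (by omega)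
    exact ⟨by rw [lev_iterate]; omega, below_iterate _ _⟩
  · omega

/-- This makes leaving an ancestor's subtree a local matter: the ends of an edge only compare their
labels on one level. -/
theorem label_ne_iff (hI : Function.Injective I) {x y u : V} {k : ℕ} (hx : t.Below x u) :
    t.label I x (t.lev u - k) ≠ t.label I y (t.lev u - k) ↔ ¬ t.Below y (t.par^[k] u) := by
  rw [← lev_iterate, label_of_below (hx.trans (below_iterate u k)), ne_comm, Ne, label_eq_iff hI]

section Finite

variable [Fintype V]

open Classical in
variable (t I) in
/-- The non-tree neighbours of `x` whose label at level `i` differs from the one of `x`. -/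
noncomputable def crossing (x : V) (i : ℕ) : Finset V :=
  Finset.univ.filter fun y => t.NonTree x y ∧ t.label I x i ≠ t.label I y i

theorem mem_crossing {x y : V} {i : ℕ} :
    y ∈ t.crossing I x i ↔ t.NonTree x y ∧ t.label I x i ≠ t.label I y i := by
  simp [crossing]

theorem crossing_zero (x : V) : t.crossing I x 0 = ∅ := by
  ext y
  simp [mem_crossing, label_zero]

open Classical in
variable (t I) in
/-- The number of crossing edges in the subtree of `u`, at the level `k` above `u`. -/
noncomputable def crossCount (u : V) (k : ℕ) : ℕ :=
  ∑ x ∈ Finset.univ.filter (fun x => t.Below x u), (t.crossing I x (t.lev u - k)).card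

open Classical in
variable (t I) in
/-- The labels at the far ends of these edges. -/
noncomputable def crossLabels (u : V) (k : ℕ) : Finset ℕ :=
  (Finset.univ.filter fun x => t.Below x u).biUnion fun x =>
    (t.crossing I x (t.lev u - k)).image fun y => t.label I y (t.lev u - k)

theorem mem_crossLabels {u : V} {k c : ℕ} : c ∈ t.crossLabels I u k ↔
    ∃ x, t.Below x u ∧ ∃ y ∈ t.crossing I x (t.lev u - k), t.label I y (t.lev u - k) = c := by
  simp [crossLabels]

/-- All labels on level `0` are that of the root. This supplies the starting values of the pipelined
sums. -/
theorem crossCount_eq_zero {u : V} {k : ℕ} (h : t.lev u ≤ k) : t.crossCount I u k = 0 := by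
  simp [crossCount, Nat.sub_eq_zero_of_le h, crossing_zero]

theorem crossLabels_eq_empty {u : V} {k : ℕ} (h : t.lev u ≤ k) : t.crossLabels I u k = ∅ := by
  ext c
  simp [mem_crossLabels, Nat.sub_eq_zero_of_le h, crossing_zero]

open Classical in
theorem sum_below (u : V) (f : V → ℕ) :
    ∑ x ∈ Finset.univ.filter (fun x => t.Below x u), f x = f u +
      ∑ c ∈ Finset.univ.filter (fun c => G.Adj u c ∧ t.par c = u),
        ∑ x ∈ Finset.univ.filter (fun x => t.Below x c), f x := by
  rw [← Finset.sum_biUnion, ← Finset.sum_insert]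
  · congr 1
    ext x
    simp only [Finset.mem_filter, Finset.mem_univ, true_and, Finset.mem_insert,
      Finset.mem_biUnion]
    exact below_iff_eq_or_child
  · simp only [Finset.mem_biUnion, Finset.mem_filter, Finset.mem_univ, true_and, not_exists,
      not_and]
    intro c hc hu
    have h₁ := lev_child hc.1 hc.2
    have h₂ := hu.lev_le
    omega
  · intro c hc c' hc' hne
    simp only [Finset.coe_filter, Finset.mem_univ, true_and, Set.mem_ofPred_eq] at hc hc'
    refine Finset.disjoint_left.2 fun x hx hx' => hne ?_
    simp only [Finset.mem_filter, Finset.mem_univ, true_and] at hx hx'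
    exact hx.eq_of_lev_eq hx' (by rw [lev_child hc.1 hc.2, lev_child hc'.1 hc'.2])

-- The absolute level `t.lev u - k` stays fixed: seen from a child, one level deeper, it has offset
-- `k + 1`. This shift is what allows pipelining.
open Classical in
theorem crossCount_rec (u : V) (k : ℕ) :
    t.crossCount I u k = (t.crossing I u (t.lev u - k)).card +
      ∑ c ∈ Finset.univ.filter (fun c => G.Adj u c ∧ t.par c = u),
        t.crossCount I c (k + 1) := by
  rw [crossCount, sum_below]
  congr 1
  refine Finset.sum_congr rfl fun c hc => ?_
  simp only [Finset.mem_filter, Finset.mem_univ, true_and] at hc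
  rw [crossCount, lev_child hc.1 hc.2, Nat.add_sub_add_right]

open Classical in
theorem crossLabels_rec (u : V) (k : ℕ) :
    t.crossLabels I u k =
      (t.crossing I u (t.lev u - k)).image (fun y => t.label I y (t.lev u - k)) ∪
      (Finset.univ.filter fun c => G.Adj u c ∧ t.par c = u).biUnion
        fun c => t.crossLabels I c (k + 1) := by
  ext a
  simp only [mem_crossLabels, Finset.mem_union, Finset.mem_image, Finset.mem_biUnion,
    Finset.mem_filter, Finset.mem_univ, true_and]
  constructor
  · rintro ⟨x, hx, hy⟩
    rcases below_iff_eq_or_child.1 hx with rfl | ⟨c, hc, hxc⟩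
    · exact .inl hy
    · refine .inr ⟨c, hc, x, hxc, ?_⟩
      rwa [lev_child hc.1 hc.2, Nat.add_sub_add_right]
  · rintro (hy | ⟨c, hc, x, hxc, hy⟩)
    · exact ⟨u, below_refl u, hy⟩
    · refine ⟨x, below_iff_eq_or_child.2 (.inr ⟨c, hc, hxc⟩), ?_⟩
      rwa [lev_child hc.1 hc.2, Nat.add_sub_add_right] at hy

open Classical in
theorem crossCount_eq_card (hI : Function.Injective I) (u : V) (k : ℕ) :
    t.crossCount I u k = (Finset.univ.filter fun e : V × V =>
      t.Below e.1 u ∧ t.NonTree e.1 e.2 ∧ ¬ t.Below e.2 (t.par^[k] u)).card := by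
  rw [Finset.card_filter, Fintype.sum_prod_type, crossCount, Finset.sum_filter]
  refine Finset.sum_congr rfl fun x _ => ?_
  by_cases hx : t.Below x u
  · simp only [hx, if_true, true_and]
    rw [← Finset.card_filter]
    congr 1
    ext y
    simp only [mem_crossing, Finset.mem_filter, Finset.mem_univ, true_and, label_ne_iff hI hx]
  · simp [hx]

theorem crossCount_zero (hI : Function.Injective I) (u : V) :
    t.crossCount I u 0 = (t.cov u).card := by
  classical
  rw [crossCount_eq_card hI, cov]
  congr 1
  ext e
  rw [Finset.mem_filter, Finset.mem_filter, Function.iterate_zero_apply]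
  tauto

theorem crossCount_le (u : V) (k : ℕ) :
    t.crossCount I u k ≤ Fintype.card V * Fintype.card V := by
  refine (Finset.sum_le_card_nsmul _ _ (Fintype.card V) fun x _ => Finset.card_le_univ _).trans ?_
  rw [smul_eq_mul]
  exact Nat.mul_le_mul_right _ (Finset.card_le_univ _)

/-- All non-tree edges that leave the subtree of `u` also leave the one of `par^[k] u`. -/
theorem crossCount_eq_iff (hI : Function.Injective I) (u : V) (k : ℕ) :
    t.crossCount I u k = t.crossCount I u 0 ↔
      ∀ x y, (x, y) ∈ t.cov u → ¬ t.Below y (t.par^[k] u) := by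
  classical
  have hsub : (Finset.univ.filter fun e : V × V =>
      t.Below e.1 u ∧ t.NonTree e.1 e.2 ∧ ¬ t.Below e.2 (t.par^[k] u)) ⊆ t.cov u := by
    rintro ⟨x, y⟩ h
    simp only [Finset.mem_filter, Finset.mem_univ, true_and] at h
    exact mem_cov.2 ⟨h.1, fun h' => h.2.2 (h'.trans (below_iterate u k)), h.2.1⟩
  rw [crossCount_zero hI, crossCount_eq_card hI]
  constructor
  · intro h x y hxy
    rw [← Finset.eq_of_subset_of_card_le hsub h.ge] at hxy
    exact (Finset.mem_filter.1 hxy).2.2.2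
  · intro h
    congr 1
    refine hsub.antisymm ?_
    rintro ⟨x, y⟩ hxy
    obtain ⟨h₁, h₂, h₃⟩ := mem_cov.1 hxy
    simp only [Finset.mem_filter, Finset.mem_univ, true_and]
    exact ⟨h₁, h₃, h x y hxy⟩

/-- The first equality says that `cov u` is contained in the `cov` of the ancestor, the second that
the inclusion is not proper. -/
theorem cov_eq_iff_ancestor (hI : Function.Injective I) (u : V) (k : ℕ) :
    t.cov u = t.cov (t.par^[k] u) ↔ t.crossCount I u k = t.crossCount I u 0 ∧
      t.crossCount I u 0 = (t.cov (t.par^[k] u)).card := by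
  rw [crossCount_eq_iff hI, crossCount_zero hI]
  constructor
  · intro h
    exact ⟨fun x y hxy => (mem_cov.1 (h ▸ hxy)).2.1, by rw [h]⟩
  · rintro ⟨h₁, h₂⟩
    refine Finset.eq_of_subset_of_card_le ?_ h₂.ge
    rintro ⟨x, y⟩ hxy
    obtain ⟨hx, -, hn⟩ := mem_cov.1 hxy
    exact mem_cov.2 ⟨hx.trans (below_iterate u k), h₁ x y hxy, hn⟩

/-- How a node recognizes that all non-tree edges leaving its subtree end in the subtree of `w`. -/
theorem crossLabels_eq_singleton_iff (hI : Function.Injective I) {u w : V} {k : ℕ}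
    (hc : t.crossCount I u k = t.crossCount I u 0) (hne : (t.cov u).Nonempty) :
    t.crossLabels I u k = {I w + 1} ↔
      t.lev w = t.lev u - k ∧ ∀ x y, (x, y) ∈ t.cov u → t.Below y w := by
  have hmem : ∀ a, a ∈ t.crossLabels I u k ↔
      ∃ x y, (x, y) ∈ t.cov u ∧ t.label I y (t.lev u - k) = a := by
    intro a
    rw [mem_crossLabels]
    constructor
    · rintro ⟨x, hx, y, hy, h⟩
      rw [mem_crossing, label_ne_iff hI hx] at hy
      exact ⟨x, y, mem_cov.2 ⟨hx, fun h' => hy.2 (h'.trans (below_iterate u k)), hy.1⟩, h⟩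
    · rintro ⟨x, y, hxy, h⟩
      obtain ⟨hx, -, hn⟩ := mem_cov.1 hxy
      refine ⟨x, hx, y, mem_crossing.2 ⟨hn, (label_ne_iff hI hx).2 ?_⟩, h⟩
      exact (crossCount_eq_iff hI u k).1 hc x y hxy
  rw [Finset.eq_singleton_iff_unique_mem]
  constructor
  · rintro ⟨h₁, h₂⟩
    obtain ⟨x, y, -, h⟩ := (hmem _).1 h₁
    refine ⟨(eq_of_label_eq hI h).1, fun x' y' hxy => ?_⟩
    exact (eq_of_label_eq hI (h₂ _ ((hmem _).2 ⟨x', y', hxy, rfl⟩))).2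
  · rintro ⟨hl, h⟩
    obtain ⟨⟨x, y⟩, hxy⟩ := hne
    refine ⟨(hmem _).2 ⟨x, y, hxy, ?_⟩, fun a ha => ?_⟩
    · rw [← hl]; exact label_of_below (h x y hxy)
    · obtain ⟨x', y', hxy', rfl⟩ := (hmem _).1 ha
      rw [← hl]; exact label_of_below (h x' y' hxy')

end Finite

end ParentTree

/-! ### Label sets of bounded size -/

/-- A set of numbers, if it has at most one element, and a fixed set of two elements otherwise. -/
def truncate (X : Finset ℕ) : Finset ℕ := if X.card ≤ 1 then X else {0, 1}

theorem card_truncate_le (X : Finset ℕ) : (truncate X).card ≤ 2 := by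
  rw [truncate]
  split
  · omega
  · simp

theorem truncate_eq_singleton_iff {X : Finset ℕ} {c : ℕ} : truncate X = {c} ↔ X = {c} := by
  rw [truncate]
  split
  · rfl
  · constructor
    · intro h
      have := congrArg Finset.card h
      simp at this
    · rintro rfl
      simp_all

/-- Truncating early is harmless: a part with two elements makes both unions have at least two, and
both become `{0, 1}`. -/
theorem truncate_union_biUnion {ι : Type} [DecidableEq ι] (X : Finset ℕ) (s : Finset ι)
    (f : ι → Finset ℕ) :
    truncate (X ∪ s.biUnion fun i => truncate (f i)) = truncate (X ∪ s.biUnion f) := by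
  by_cases h : ∀ i ∈ s, (f i).card ≤ 1
  · congr 2
    exact Finset.biUnion_congr rfl fun i hi => if_pos (h i hi)
  · push Not at h
    obtain ⟨i, hi, hlt⟩ := h
    have h₁ : 1 < (X ∪ s.biUnion f).card := hlt.trans_le <| Finset.card_le_card <|
      (Finset.subset_biUnion_of_mem f hi).trans Finset.subset_union_right
    have h₂ : 1 < (X ∪ s.biUnion fun i => truncate (f i)).card := by
      have : ({0, 1} : Finset ℕ) ⊆ X ∪ s.biUnion fun i => truncate (f i) := by
        have := (Finset.subset_biUnion_of_mem (fun i => truncate (f i)) hi).trans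
          (Finset.subset_union_right (s₁ := X))
        rwa [truncate, if_neg (by omega)] at this
      exact (by simp : 1 < ({0, 1} : Finset ℕ).card).trans_le (Finset.card_le_card this)
    rw [truncate, if_neg (by omega), truncate, if_neg (by omega)]

/-! ### Gathering information along a tree -/

/-- What a node knows about its place in a rooted spanning tree, in terms of identifiers. -/
structure LocalView where
  /-- the node's identifier -/
  me : ℕ
  /-- the identifiers of its neighbours -/
  nbrs : Finset ℕ
  /-- its level -/
  lev : ℕ
  /-- the identifier of its parent -/
  par : ℕ
  /-- the levels of the neighbours -/
  nbrLev : ℕ → ℕ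
  /-- the parents of the neighbours -/
  nbrPar : ℕ → ℕ

namespace LocalView

open NodeProgram

variable (E : LocalView)

/-- The label of the node `i` (the node itself or a neighbour) at level `l`, when `hist k i` is the
value at the `k`-th ancestor of `i`. -/
def label (hist : ℕ → ℕ → ℕ) (i l : ℕ) : ℕ :=
  let L := if i = E.me then E.lev else E.nbrLev i
  if l ≤ L then hist (L - l) i + 1 else 0

/-- The non-tree neighbours with a different label at level `l`. -/
def crossing (hist : ℕ → ℕ → ℕ) (l : ℕ) : Finset ℕ :=
  E.nbrs.filter fun i => (E.par ≠ i ∧ E.nbrPar i ≠ E.me) ∧ E.label hist E.me l ≠ E.label hist i l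

/-- The children of the node. -/
def children : Finset ℕ := E.nbrs.filter fun i => E.nbrPar i = E.me

/-- One round of passing values down the tree; all values received are recorded. -/
def ascendUpdate (k : ℕ) (s : ℕ × (ℕ → ℕ → ℕ)) (ib : ℕ → List ℕ) : ℕ × (ℕ → ℕ → ℕ) :=
  (if E.par = E.me then s.1 else (ib E.par).headD 0,
    Function.update s.2 k fun i => if i = E.me then s.1 else (ib i).headD 0)

/-- One round of adding up counts and collecting labels towards the root. -/
def collectUpdate (d : ℕ) (hist : ℕ → ℕ → ℕ) (r : ℕ)
    (s : (ℕ × Finset ℕ) × (ℕ → ℕ × Finset ℕ)) (ib : ℕ → List ℕ) :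
    (ℕ × Finset ℕ) × (ℕ → ℕ × Finset ℕ) :=
  -- Round `r` treats the offset `k = d - r`; in the round before, the children obtained their
  -- values at `k + 1`, which are the ones received now.
  let l := E.lev - (d - r)
  let new : ℕ × Finset ℕ :=
    ((E.crossing hist l).card + ∑ i ∈ E.children, (ib i).headD 0,
      truncate ((E.crossing hist l).image (fun i => E.label hist i l) ∪
        E.children.biUnion fun i => (ib i).tail.toFinset))
  (new, Function.update s.2 (d - r) new)

/-- The values `val` of the `k`-th ancestors of the node and its neighbours, for `k ≤ d`, and the
counts and labels of the crossing edges. -/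
noncomputable def gather (d val : ℕ) :
    NodeProgram ((ℕ → ℕ → ℕ) × (ℕ → ℕ × Finset ℕ)) :=
  (loop (fun _ s => [s.1]) E.ascendUpdate (d + 1) 0 (val, fun _ _ => 0)).bind fun a =>
    (loop (fun _ s => s.1.1 :: s.1.2.toList) (E.collectUpdate d a.2) (d + 1) 0
      ((0, ∅), fun _ => (0, ∅))).bind fun c => done (a.2, c.2)

variable {V : Type} [Fintype V] {G : SimpleGraph V}

/-- The views `E v` describe the tree `t` correctly. -/
structure Valid (t : ParentTree G) (ident : V ↪ ℕ) (E : V → LocalView) : Prop where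
  me : ∀ v, (E v).me = ident v
  nbrs : ∀ v, (E v).nbrs = nbrIds G ident v
  lev : ∀ v, (E v).lev = t.lev v
  par : ∀ v, (E v).par = ident (t.par v)
  nbrLev : ∀ v w, G.Adj v w → (E v).nbrLev (ident w) = t.lev w
  nbrPar : ∀ v w, G.Adj v w → (E v).nbrPar (ident w) = ident (t.par w)

variable {t : ParentTree G} {ident : V ↪ ℕ} {E : V → LocalView} {I : V → ℕ} {b d : ℕ}

/-- `hist` records the values `I` at the ancestors of the nodes and of their neighbours. -/
def Records (t : ParentTree G) (ident : V ↪ ℕ) (I : V → ℕ) (d : ℕ) (hist : V → ℕ → ℕ → ℕ) : Prop :=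
  ∀ v w, (w = v ∨ G.Adj v w) → ∀ k ≤ d, hist v k (ident w) = I (t.par^[k] w)

theorem Valid.label_eq (hE : Valid t ident E) {hist : V → ℕ → ℕ → ℕ}
    (hh : Records t ident I d hist) (hd : ∀ v, t.lev v ≤ d) {v w : V}
    (hw : w = v ∨ G.Adj v w) (l : ℕ) :
    (E v).label (hist v) (ident w) l = t.label I w l := by
  have hL : (if ident w = (E v).me then (E v).lev else (E v).nbrLev (ident w)) = t.lev w := by
    rw [hE.me]
    rcases hw with rfl | hw
    · rw [if_pos rfl, hE.lev]
    · rw [if_neg fun h => G.ne_of_adj hw (ident.injective h).symm, hE.nbrLev v w hw]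
  simp only [label, ParentTree.label, hL]
  rw [hh v w hw _ ((Nat.sub_le _ _).trans (hd w))]

theorem Valid.crossing_eq (hE : Valid t ident E) {hist : V → ℕ → ℕ → ℕ}
    (hh : Records t ident I d hist) (hd : ∀ v, t.lev v ≤ d) (v : V) (l : ℕ) :
    (E v).crossing (hist v) l = (t.crossing I v l).map ident := by
  ext i
  simp only [crossing, Finset.mem_filter, Finset.mem_map, ParentTree.mem_crossing, hE.nbrs,
    mem_nbrIds, hE.par, hE.me, ParentTree.NonTree]
  constructor
  · rintro ⟨⟨w, hw, rfl⟩, ⟨h₁, h₂⟩, h₃⟩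
    rw [hE.nbrPar v w hw] at h₂
    rw [hE.label_eq hh hd (.inl rfl), hE.label_eq hh hd (.inr hw)] at h₃
    exact ⟨w, ⟨⟨hw, fun h => h₁ (by rw [h]), fun h => h₂ (by rw [h])⟩, h₃⟩, rfl⟩
  · rintro ⟨w, ⟨⟨hw, h₁, h₂⟩, h₃⟩, rfl⟩
    refine ⟨⟨w, hw, rfl⟩, ⟨fun h => h₁ (ident.injective h), ?_⟩, ?_⟩
    · rw [hE.nbrPar v w hw]
      exact fun h => h₂ (ident.injective h)
    · rwa [hE.label_eq hh hd (.inl rfl), hE.label_eq hh hd (.inr hw)]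

open Classical in
theorem Valid.children_eq (hE : Valid t ident E) (v : V) :
    (E v).children = (Finset.univ.filter fun c => G.Adj v c ∧ t.par c = v).map ident := by
  ext i
  simp only [children, Finset.mem_filter, Finset.mem_map, hE.nbrs, mem_nbrIds, hE.me,
    Finset.mem_univ, true_and]
  constructor
  · rintro ⟨⟨w, hw, rfl⟩, h⟩
    rw [hE.nbrPar v w hw] at h
    exact ⟨w, ⟨hw, ident.injective h⟩, rfl⟩
  · rintro ⟨w, ⟨hw, h⟩, rfl⟩
    exact ⟨⟨w, hw, rfl⟩, by rw [hE.nbrPar v w hw, h]⟩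

/-- In round `r` each node broadcasts the value of its `r`-th ancestor. It thus takes the next value
from its parent and overhears those of all its neighbours. -/
theorem Valid.ascend (hE : Valid t ident E) (hb : ∀ v, I v < 2 ^ b) :
    ∃ res, Runs G ident b (d + 1)
      (fun v => loop (fun _ s => [s.1]) (E v).ascendUpdate (d + 1) 0 (I v, fun _ _ => 0)) res ∧
      Records t ident I d fun v => (res v).2 := by
  set σ := loopState G ident (fun _ _ (s : ℕ × (ℕ → ℕ → ℕ)) => [s.1])
    (fun v => (E v).ascendUpdate) fun v => (I v, fun _ _ => 0)
  have key : ∀ r, (∀ v, (σ r v).1 = I (t.par^[r] v)) ∧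
      ∀ v w, (w = v ∨ G.Adj v w) → ∀ k < r, (σ r v).2 k (ident w) = I (t.par^[k] w) := by
    intro r
    induction r with
    | zero => exact ⟨fun v => rfl, fun v w _ k hk => absurd hk (Nat.not_lt_zero k)⟩
    | succ r ih =>
      have hstep : ∀ v, σ (r + 1) v = (E v).ascendUpdate r (σ r v)
        (delivered G ident (fun w => [(σ r w).1]) v) := fun v => rfl
      have hdel : ∀ v w, G.Adj v w → (delivered G ident (fun w => [(σ r w).1]) v
          (ident w)).headD 0 = I (t.par^[r] w) := by
        intro v w hw
        rw [delivered_of_adj _ _ _ hw, ← ih.1]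
        rfl
      refine ⟨fun v => ?_, fun v w hw k hk => ?_⟩
      · rw [hstep, ascendUpdate, hE.par, hE.me, Function.iterate_succ_apply]
        by_cases hr : v = t.root
        · rw [if_pos (by rw [hr, t.par_root]), ih.1, hr, t.par_root]
        · have ha := t.adj_par v hr
          rw [if_neg fun h => G.ne_of_adj ha (ident.injective h).symm]
          exact hdel v _ ha
      · rw [hstep, ascendUpdate]
        rcases Nat.lt_succ_iff_lt_or_eq.1 hk with hk | rfl
        · simp only [Function.update_of_ne hk.ne]
          exact ih.2 v w hw k hk
        · simp only [Function.update_self, hE.me]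
          rcases hw with rfl | hw
          · rw [if_pos rfl, ih.1]
          · rw [if_neg fun h => G.ne_of_adj hw (ident.injective h).symm]
            exact hdel v w hw
  refine ⟨σ (d + 1), Runs.loop fun r _ v => ?_, fun v w hw k hk =>
    (key (d + 1)).2 v w hw k (by omega)⟩
  refine ⟨by simp, fun x hx => ?_⟩
  obtain rfl : x = (σ r v).1 := by simpa using hx
  rw [(key r).1]
  exact hb _

theorem mem_truncate_crossLabels_lt (hb : ∀ v, I v + 1 < 2 ^ b) {v : V} {k x : ℕ}
    (hx : x ∈ truncate (t.crossLabels I v k)) : x < 2 ^ b := by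
  rw [truncate] at hx
  split at hx
  · obtain ⟨_, _, y, _, rfl⟩ := ParentTree.mem_crossLabels.1 hx
    exact ParentTree.label_lt hb y _
  · have := hb v
    simp only [Finset.mem_insert, Finset.mem_singleton] at hx
    omega

/-- The invariant starts at offset `d + 1`, beyond every level, where the initial `(0, ∅)` is
correct, and descends by one offset per round. -/
theorem Valid.collect (hE : Valid t ident E) {hist : V → ℕ → ℕ → ℕ}
    (hh : Records t ident I d hist) (hd : ∀ v, t.lev v ≤ d) (hb : ∀ v, I v + 1 < 2 ^ b)
    (hn : Fintype.card V * Fintype.card V < 2 ^ b) :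
    ∃ res, Runs G ident b (d + 1)
      (fun v => loop (fun _ s => s.1.1 :: s.1.2.toList) ((E v).collectUpdate d (hist v)) (d + 1) 0
        ((0, ∅), fun _ => (0, ∅))) res ∧
      ∀ v, ∀ k ≤ d, (res v).2 k = (t.crossCount I v k, truncate (t.crossLabels I v k)) := by
  classical
  set σ := loopState G ident
    (fun _ _ (s : (ℕ × Finset ℕ) × (ℕ → ℕ × Finset ℕ)) => s.1.1 :: s.1.2.toList)
    (fun v => (E v).collectUpdate d (hist v)) fun v => ((0, ∅), fun _ => (0, ∅))
  have key : ∀ r ≤ d + 1, (∀ v, (σ r v).1 =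
      (t.crossCount I v (d + 1 - r), truncate (t.crossLabels I v (d + 1 - r)))) ∧
      ∀ v k, d + 1 - r ≤ k → k ≤ d →
        (σ r v).2 k = (t.crossCount I v k, truncate (t.crossLabels I v k)) := by
    intro r
    induction r with
    | zero =>
      refine fun _ => ⟨fun v => ?_, fun v k h₁ h₂ => by omega⟩
      have := hd v
      rw [ParentTree.crossCount_eq_zero (by omega), ParentTree.crossLabels_eq_empty (by omega)]
      rfl
    | succ r ih =>
      intro hr
      obtain ⟨ih₁, ih₂⟩ := ih (by omega)
      have hk : d + 1 - (r + 1) = d - r := by omega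
      have hk' : d + 1 - r = d - r + 1 := by omega
      have hdel : ∀ v w, G.Adj v w → delivered G ident
          (fun w => (σ r w).1.1 :: (σ r w).1.2.toList) v (ident w) =
          t.crossCount I w (d - r + 1) :: (truncate (t.crossLabels I w (d - r + 1))).toList := by
        intro v w hw
        rw [delivered_of_adj _ _ _ hw, ih₁, hk']
      have hnew : ∀ v, σ (r + 1) v =
          ((t.crossCount I v (d - r), truncate (t.crossLabels I v (d - r))),
            Function.update (σ r v).2 (d - r)
              (t.crossCount I v (d - r), truncate (t.crossLabels I v (d - r)))) := by
        intro v
        have hstep : σ (r + 1) v = (E v).collectUpdate d (hist v) r (σ r v)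
          (delivered G ident (fun w => (σ r w).1.1 :: (σ r w).1.2.toList) v) := rfl
        have hcount : ((E v).crossing (hist v) ((E v).lev - (d - r))).card +
            ∑ i ∈ (E v).children, (delivered G ident
              (fun w => (σ r w).1.1 :: (σ r w).1.2.toList) v i).headD 0 =
            t.crossCount I v (d - r) := by
          rw [ParentTree.crossCount_rec, hE.crossing_eq hh hd, Finset.card_map, hE.lev,
            hE.children_eq, Finset.sum_map]
          congr 1
          refine Finset.sum_congr rfl fun c hc => ?_
          rw [hdel v c (Finset.mem_filter.1 hc).2.1]
          rfl
        have hlab : truncate (((E v).crossing (hist v) ((E v).lev - (d - r))).image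
              (fun i => (E v).label (hist v) i ((E v).lev - (d - r))) ∪
            (E v).children.biUnion fun i => (delivered G ident
              (fun w => (σ r w).1.1 :: (σ r w).1.2.toList) v i).tail.toFinset) =
            truncate (t.crossLabels I v (d - r)) := by
          rw [ParentTree.crossLabels_rec]
          refine Eq.trans ?_ (truncate_union_biUnion _ _ _)
          rw [hE.crossing_eq hh hd, hE.lev, hE.children_eq, Finset.map_eq_image, Finset.map_eq_image, Finset.image_image,
            Finset.image_biUnion]
          congr 2
          · refine Finset.image_congr fun y hy => ?_
            exact hE.label_eq hh hd (.inr (ParentTree.mem_crossing.1 hy).1.1) _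
          · refine Finset.biUnion_congr rfl fun c hc => ?_
            rw [hdel v c (Finset.mem_filter.1 hc).2.1]
            simp
        rw [hstep, collectUpdate]
        simp only [hcount, hlab]
      refine ⟨fun v => by rw [hnew, hk], fun v k h₁ h₂ => ?_⟩
      rw [hnew]
      by_cases hkr : k = d - r
      · simp only [hkr, Function.update_self]
      · simp only [Function.update_of_ne hkr]
        exact ih₂ v k (by omega) h₂
  refine ⟨σ (d + 1), Runs.loop fun r hr v => ?_, fun v k hk =>
    (key (d + 1) le_rfl).2 v k (by omega) hk⟩
  change Fits b ((σ r v).1.1 :: (σ r v).1.2.toList)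
  rw [(key r hr.le).1]
  refine ⟨?_, fun x hx => ?_⟩
  · have := card_truncate_le (t.crossLabels I v (d + 1 - r))
    simpa [Nat.lt_succ_iff] using this
  · rw [List.mem_cons, Finset.mem_toList] at hx
    rcases hx with rfl | hx
    · exact (ParentTree.crossCount_le _ _).trans_lt hn
    · exact mem_truncate_crossLabels_lt hb hx

theorem Valid.gather (hE : Valid t ident E) (hd : ∀ v, t.lev v ≤ d)
    (hb : ∀ v, I v + 1 < 2 ^ b) (hn : Fintype.card V * Fintype.card V < 2 ^ b) :
    ∃ res, Runs G ident b ((d + 1) + ((d + 1) + 0)) (fun v => (E v).gather d (I v)) res ∧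
      Records t ident I d (fun v => (res v).1) ∧
      ∀ v, ∀ k ≤ d, (res v).2 k = (t.crossCount I v k, truncate (t.crossLabels I v k)) := by
  obtain ⟨r₁, h₁, hr₁⟩ := hE.ascend (d := d) fun v => (Nat.lt_succ_self _).trans (hb v)
  obtain ⟨r₂, h₂, hr₂⟩ := hE.collect hr₁ hd hb hn
  exact ⟨fun v => ((r₁ v).2, (r₂ v).2), h₁.bind (h₂.bind (Runs.pure _)), hr₁, hr₂⟩

end LocalView

/-! ### Reporting the cuts -/

namespace ParentTree

variable {V : Type} [Fintype V] {G : SimpleGraph V}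

/-- The identifiers of a node and its parent and the number of non-tree edges that leave its
subtree, in one number. -/
noncomputable def info (t : ParentTree G) (ident : V ↪ ℕ) (v : V) : ℕ :=
  Nat.pair (ident v) (Nat.pair (ident (t.par v)) (t.cov v).card)

theorem info_injective (t : ParentTree G) (ident : V ↪ ℕ) :
    Function.Injective (t.info ident) := fun _ _ h =>
  ident.injective (Nat.pair_eq_pair.1 h).1

end ParentTree

namespace LocalView

open ParentTree

/-- The tree edge described by the `info` of a node. -/
def infoEdge (n : ℕ) : Sym2 ℕ := s(n.unpair.1, n.unpair.2.unpair.1)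

/-- The number of non-tree edges given by the `info` of a node. -/
def infoCount (n : ℕ) : ℕ := n.unpair.2.unpair.2

open Classical in
/-- The cuts of size two which a node finds in the information it has gathered. -/
noncomputable def report (E : LocalView) (hist : ℕ → ℕ → ℕ) (res : ℕ → ℕ × Finset ℕ) :
    Finset (Finset (Sym2 ℕ)) :=
  -- The three parts match the nested, the disjoint and the mixed shape. Offsets below `E.lev` keep
  -- the second tree edge away from the root; `0` is allowed in the disjoint shape, where both
  -- vertices may have the same level.
  ((Finset.range E.lev).filter fun k => k ≠ 0 ∧ (res k).1 = (res 0).1 ∧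
      (res 0).1 = infoCount (hist k E.me)).image
    (fun k => {s(E.me, E.par), infoEdge (hist k E.me)}) ∪
  ((Finset.range E.lev).filter fun k => ∃ c, (res k).2 = {c + 1} ∧ (res k).1 = (res 0).1 ∧
      (res 0).1 = infoCount c).image
    (fun k => {s(E.me, E.par), infoEdge ((res k).2.sup id - 1)}) ∪
  ((Finset.range E.lev ×ˢ E.nbrs).filter fun p => p.2 ∈ E.crossing hist (E.lev - p.1) ∧
      infoCount (hist p.1 E.me) = 1).image
    (fun p => {infoEdge (hist p.1 E.me), s(E.me, p.2)})

open Classical in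
theorem map_pair {V : Type} {ident : V ↪ ℕ} (e f : Sym2 V) :
    ({e, f} : Finset (Sym2 V)).map ident.sym2Map = {ident.sym2Map e, ident.sym2Map f} := by
  rw [Finset.map_insert, Finset.map_singleton]

variable {V : Type} [Fintype V] {G : SimpleGraph V} {t : ParentTree G} {ident : V ↪ ℕ}
  {E : V → LocalView} {d : ℕ} {hist : V → ℕ → ℕ → ℕ} {res : V → ℕ → ℕ × Finset ℕ}

theorem infoEdge_info (v : V) : infoEdge (t.info ident v) = ident.sym2Map (t.edge v) := by
  simp [infoEdge, info, edge]

theorem infoCount_info (v : V) : infoCount (t.info ident v) = (t.cov v).card := by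
  simp [infoCount, info]

theorem Valid.edge_eq (hE : Valid t ident E) (v : V) :
    s((E v).me, (E v).par) = ident.sym2Map (t.edge v) := by
  simp [hE.me, hE.par, edge]

/-- Whatever a node reports is a cut of size two. -/
theorem Valid.report_sound (hE : Valid t ident E) (hd : ∀ v, t.lev v ≤ d)
    (hh : Records t ident (t.info ident) d hist)
    (hres : ∀ v, ∀ k ≤ d, res v k = (t.crossCount (t.info ident) v k,
      truncate (t.crossLabels (t.info ident) v k)))
    (hcov : ∀ u, u ≠ t.root → (t.cov u).Nonempty) {v : V} {S : Finset (Sym2 ℕ)}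
    (hS : S ∈ (E v).report (hist v) (res v)) :
    ∃ F, IsCut G F ∧ F.card = 2 ∧ S = F.map ident.sym2Map := by
  classical
  have hI := t.info_injective ident
  have hself : ∀ k ≤ d, hist v k (E v).me = t.info ident (t.par^[k] v) := fun k hk => by
    rw [hE.me]; exact hh v v (.inl rfl) k hk
  have hdv := hd v
  simp only [report, Finset.mem_union, Finset.mem_image, Finset.mem_filter, Finset.mem_range,
    Finset.mem_product, hE.lev] at hS
  rcases hS with (⟨k, ⟨hk, hk₀, h₁, h₂⟩, rfl⟩ | ⟨k, ⟨hk, c, hc, h₁, h₂⟩, rfl⟩) |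
    ⟨⟨k, i⟩, ⟨⟨hk, -⟩, hi, h₁⟩, rfl⟩
  · rw [hres v k (by omega), hres v 0 (by omega)] at h₁
    rw [hres v 0 (by omega), hself k (by omega), infoCount_info] at h₂
    rw [hself k (by omega), infoEdge_info, hE.edge_eq, ← map_pair]
    have hv : v ≠ t.root := by
      rintro rfl
      rw [t.lev_root] at hk
      omega
    have hne : v ≠ t.par^[k] v := by
      intro h
      have := lev_iterate (t := t) k v
      rw [← h] at this
      omega
    obtain ⟨h₃, h₄⟩ := isCut_of_below hv (iterate_ne_root hk) hne (below_iterate v k)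
      ((cov_eq_iff_ancestor hI v k).2 ⟨h₁, h₂⟩)
    exact ⟨_, h₃, h₄, rfl⟩
  · rw [hres v k (by omega), hres v 0 (by omega)] at h₁
    rw [hres v 0 (by omega)] at h₂
    rw [hres v k (by omega)] at hc ⊢
    simp only at h₁ h₂ hc ⊢
    have hv : v ≠ t.root := by
      rintro rfl
      rw [t.lev_root] at hk
      omega
    rw [hc, Finset.sup_singleton, id, Nat.add_sub_cancel]
    rw [truncate_eq_singleton_iff] at hc
    obtain ⟨w, rfl⟩ : ∃ w, c = t.info ident w := by
      have hm : c + 1 ∈ t.crossLabels (t.info ident) v k := by simp [hc]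
      obtain ⟨x, -, y, -, hy⟩ := mem_crossLabels.1 hm
      rcases label_eq_zero_or (t := t) (I := t.info ident) y (t.lev v - k) with h | ⟨w, h⟩
      · omega
      · exact ⟨w, by omega⟩
    obtain ⟨hl, hb⟩ := (crossLabels_eq_singleton_iff hI h₁ (hcov v hv)).1 hc
    obtain ⟨⟨x, y⟩, hxy⟩ := hcov v hv
    have hny := (crossCount_eq_iff hI v k).1 h₁ x y hxy
    have hyw := hb x y hxy
    have hw : w ≠ t.root := by
      rintro rfl
      rw [t.lev_root] at hl
      omega
    -- Otherwise `w` would be the `k`-th ancestor of `v`, whose subtree all edges of `cov v` leave.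
    have hvw : ¬ t.Below v w := by
      intro h
      have : w = t.par^[k] v := h.eq_of_lev_eq (below_iterate v k) (by rw [lev_iterate, hl])
      exact hny (this ▸ hyw)
    have hwv : ¬ t.Below w v := fun h => (mem_cov.1 hxy).2.1 (hyw.trans h)
    rw [infoCount_info, crossCount_zero hI] at h₂
    obtain ⟨h₃, h₄⟩ := isCut_of_disjoint hv hw hvw hwv hb (below_of_card_cov_eq hvw hwv hb h₂)
    rw [infoEdge_info, hE.edge_eq, ← map_pair]
    exact ⟨_, h₃, h₄, rfl⟩
  · simp only at hi h₁ hk ⊢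
    rw [hE.crossing_eq hh hd, Finset.mem_map] at hi
    obtain ⟨y, hy, rfl⟩ := hi
    rw [mem_crossing, label_ne_iff hI (below_refl v)] at hy
    rw [hself k (by omega), infoCount_info] at h₁
    obtain ⟨e, he⟩ := Finset.card_eq_one.1 h₁
    have hm : (v, y) ∈ t.cov (t.par^[k] v) := mem_cov.2 ⟨below_iterate v k, hy.2, hy.1⟩
    rw [he, Finset.mem_singleton] at hm
    obtain ⟨h₃, h₄⟩ := isCut_of_cov_singleton (hm ▸ he)
    refine ⟨_, h₃, h₄, ?_⟩
    rw [map_pair, hself k (by omega), infoEdge_info, hE.me]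
    rfl

/-- Every cut of size two is reported by an endpoint of one of its edges. -/
theorem Valid.report_complete (hE : Valid t ident E) (hd : ∀ v, t.lev v ≤ d)
    (hh : Records t ident (t.info ident) d hist)
    (hres : ∀ v, ∀ k ≤ d, res v k = (t.crossCount (t.info ident) v k,
      truncate (t.crossLabels (t.info ident) v k)))
    (hcov : ∀ u, u ≠ t.root → (t.cov u).Nonempty) {F : Finset (Sym2 V)} (hF : IsCut G F)
    (hc : F.card = 2) :
    ∃ e ∈ F, ∃ v ∈ e, F.map ident.sym2Map ∈ (E v).report (hist v) (res v) := by
  classical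
  have hI := t.info_injective ident
  have hself : ∀ v, ∀ k ≤ d, hist v k (E v).me = t.info ident (t.par^[k] v) := fun v k hk => by
    rw [hE.me]; exact hh v v (.inl rfl) k hk
  rcases cut_cases (t := t) hF hc with ⟨a, x, y, ha, rfl⟩ |
    ⟨u, w, hu, hw, hne, huw, hcv, rfl⟩ | ⟨u, w, hu, hw, huw, hwu, hl, hb, hcard, rfl⟩
  -- Here the inner end of the non-tree edge reports: it knows this edge, and the `info` of its
  -- ancestor `a` describes the tree edge and says that it is covered once.
  · refine ⟨s(x, y), by simp, x, by simp, ?_⟩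
    have hm : (x, y) ∈ t.cov a := by simp [ha]
    obtain ⟨hx, hy, hn⟩ := mem_cov.1 hm
    have hlev := lev_ne_zero (ne_root_of_not_below hy)
    have hle := hx.lev_le
    obtain ⟨k, hk, rfl⟩ : ∃ k < t.lev x, t.par^[k] x = a :=
      ⟨_, by omega, (below_iff.1 hx).2⟩
    have hdx := hd x
    rw [report, Finset.mem_union]
    refine .inr (Finset.mem_image.2 ⟨(k, ident y), Finset.mem_filter.2 ⟨?_, ?_, ?_⟩, ?_⟩)
    · rw [Finset.mem_product, hE.lev, hE.nbrs, NodeProgram.mem_nbrIds, Finset.mem_range]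
      exact ⟨hk, y, hn.1, rfl⟩
    · rw [hE.crossing_eq hh hd, Finset.mem_map]
      refine ⟨y, mem_crossing.2 ⟨hn, ?_⟩, rfl⟩
      rw [hE.lev, label_ne_iff hI (below_refl x)]
      exact hy
    · rw [hself x k (by omega), infoCount_info, ha, Finset.card_singleton]
    · rw [map_pair, hself x k (by omega), infoEdge_info, hE.me]
      rfl
  · refine ⟨t.edge u, by simp, u, by simp [edge], ?_⟩
    have hlev := lev_ne_zero hw
    have hle := huw.lev_le
    have hdu := hd u
    obtain ⟨k, hk, rfl⟩ : ∃ k < t.lev u, t.par^[k] u = w :=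
      ⟨_, by omega, (below_iff.1 huw).2⟩
    rw [report, Finset.mem_union, Finset.mem_union]
    refine .inl (.inl (Finset.mem_image.2 ⟨k, Finset.mem_filter.2 ⟨?_, ?_, ?_⟩, ?_⟩))
    · rwa [hE.lev, Finset.mem_range]
    · rintro rfl
      exact hne rfl
    · rw [hres u k (by omega), hres u 0 (by omega), hself u k (by omega), infoCount_info]
      exact (cov_eq_iff_ancestor hI u k).1 hcv
    · rw [map_pair, hself u k (by omega), infoEdge_info, hE.edge_eq]
  · refine ⟨t.edge u, by simp, u, by simp [edge], ?_⟩
    have hlev := lev_ne_zero hw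
    have hdu := hd u
    obtain ⟨k, hk, hkw⟩ : ∃ k < t.lev u, t.lev w = t.lev u - k :=
      ⟨t.lev u - t.lev w, by omega, by omega⟩
    have h₁ : t.crossCount (t.info ident) u k = t.crossCount (t.info ident) u 0 := by
      rw [crossCount_eq_iff hI]
      intro x y hxy hy
      have : w = t.par^[k] u := (hb x y hxy).eq_of_lev_eq hy (by rw [lev_iterate, hkw])
      exact huw (this ▸ below_iterate u k)
    have h₂ := (crossLabels_eq_singleton_iff hI h₁ (hcov u hu)).2 ⟨hkw, hb⟩
    rw [report, Finset.mem_union, Finset.mem_union]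
    refine .inl (.inr (Finset.mem_image.2 ⟨k, Finset.mem_filter.2 ⟨?_, ?_⟩, ?_⟩))
    · rwa [hE.lev, Finset.mem_range]
    · rw [hres u k (by omega), hres u 0 (by omega)]
      refine ⟨_, truncate_eq_singleton_iff.2 h₂, h₁, ?_⟩
      rw [infoCount_info, crossCount_zero hI]
      exact hcard
    · rw [hres u k (by omega)]
      simp only [truncate_eq_singleton_iff.2 h₂]
      rw [Finset.sup_singleton, id, Nat.add_sub_cancel, infoEdge_info, map_pair, hE.edge_eq]

-- A bridge excludes min-cuts of size two, so the empty output is right; without one, cuts of size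
-- two are automatically minimal.
open Classical in
theorem Valid.findsAllMinCuts (hE : Valid t ident E) (hd : ∀ v, t.lev v ≤ d)
    (hh : Records t ident (t.info ident) d hist)
    (hres : ∀ v, ∀ k ≤ d, res v k = (t.crossCount (t.info ident) v k,
      truncate (t.crossLabels (t.info ident) v k))) :
    FindsAllMinCuts G ident 2 fun v =>
      if ∃ u, u ≠ t.root ∧ (t.cov u).card = 0 then ∅ else (E v).report (hist v) (res v) := by
  by_cases h : ∃ u, u ≠ t.root ∧ (t.cov u).card = 0
  · simp only [h, if_true]
    refine ⟨fun v S hS => absurd hS (Finset.notMem_empty S), fun F hF hc => ?_⟩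
    obtain ⟨u, hu, h₀⟩ := h
    have := Finset.card_pos.2 (cov_nonempty_of_isMinCut (t := t) hF hc hu)
    omega
  · simp only [h, if_false]
    push Not at h
    have hcov : ∀ u, u ≠ t.root → (t.cov u).Nonempty := fun u hu =>
      Finset.card_ne_zero.1 (h u hu)
    refine ⟨fun v S hS => ?_, fun F hF hc => hE.report_complete hd hh hres hcov hF.1 hc⟩
    obtain ⟨F, h₁, h₂, h₃⟩ := hE.report_sound hd hh hres hcov hS
    exact ⟨F, isMinCut_of_isCut hcov h₁ h₂, h₂, h₃⟩

end LocalView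

/-! ### Leader election -/

open NodeProgram

/-- What a node knows while the smallest identifier is spread. -/
structure FloodState where
  /-- the smallest identifier seen so far -/
  leader : ℕ
  /-- the length of a path to the leader -/
  lev : ℕ
  /-- the neighbour from which the leader was learnt -/
  par : ℕ

/-- A round of spreading the smallest identifier. -/
noncomputable def floodUpdate (nbrs : Finset ℕ) (_ : ℕ) (s : FloodState) (ib : ℕ → List ℕ) :
    FloodState :=
  open Classical in
  if h : ∃ i ∈ nbrs, (ib i).headD 0 < s.leader ∧ ∀ j ∈ nbrs, (ib i).headD 0 ≤ (ib j).headD 0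
  then ⟨(ib h.choose).headD 0, (ib h.choose).getD 1 0 + 1, h.choose⟩ else s

/-- The program that spreads the smallest identifier for `d` rounds. -/
noncomputable def flood (d me : ℕ) (nbrs : Finset ℕ) : NodeProgram FloodState :=
  loop (fun _ s => [s.leader, s.lev]) (floodUpdate nbrs) d 0 ⟨me, 0, me⟩

/-- A round of spreading an alarm, which is raised where neighbouring values `m` differ. -/
def alarmUpdate (m : ℕ) (nbrs : Finset ℕ) (_ : ℕ) (s : Prop) (ib : ℕ → List ℕ) : Prop :=
  s ∨ ∃ i ∈ nbrs, (ib i).headD 0 ≠ m ∨ (ib i).getD 1 0 ≠ 0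

open Classical in
/-- The program that spreads an alarm for `d` rounds. -/
noncomputable def alarm (d m : ℕ) (nbrs : Finset ℕ) (s : Prop) : NodeProgram Prop :=
  loop (fun _ s => [m, if s then 1 else 0]) (alarmUpdate m nbrs) d 0 s

theorem SimpleGraph.Connected.exists_adj_dist_le {V : Type} {G : SimpleGraph V}
    (hG : G.Connected) {v w : V} {r : ℕ} (h : G.dist v w ≤ r + 1) (hne : v ≠ w) :
    ∃ x, G.Adj v x ∧ G.dist x w ≤ r := by
  obtain ⟨p, hp⟩ := hG.exists_walk_length_eq_dist v w
  cases p with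
  | nil => exact absurd rfl hne
  | cons hadj q =>
    refine ⟨_, hadj, (SimpleGraph.dist_le q).trans ?_⟩
    rw [SimpleGraph.Walk.length_cons] at hp
    omega

/-! ### Correctness of flooding and alarms -/

section Flood

variable {V : Type} [Fintype V] (G : SimpleGraph V) (ident : V ↪ ℕ)

/-- The states of all nodes after `r` rounds of spreading the smallest identifier. -/
noncomputable def floodState : ℕ → V → FloodState :=
  loopState G ident (fun _ _ s => [s.leader, s.lev]) (fun v => floodUpdate (nbrIds G ident v))
    fun v => ⟨ident v, 0, ident v⟩

variable {G ident}

theorem floodState_succ (r : ℕ) (v : V) :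
    (∃ w, G.Adj v w ∧ (floodState G ident r w).leader < (floodState G ident r v).leader ∧
      (∀ x, G.Adj v x → (floodState G ident r w).leader ≤ (floodState G ident r x).leader) ∧
      floodState G ident (r + 1) v =
        ⟨(floodState G ident r w).leader, (floodState G ident r w).lev + 1, ident w⟩) ∨
    (floodState G ident (r + 1) v = floodState G ident r v ∧
      ∀ x, G.Adj v x → (floodState G ident r v).leader ≤ (floodState G ident r x).leader) := by
  set σ := floodState G ident r
  set ib := delivered G ident (fun w => [(σ w).leader, (σ w).lev]) v
  have hdel : ∀ w, G.Adj v w → ib (ident w) = [(σ w).leader, (σ w).lev] := fun w hw =>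
    delivered_of_adj _ _ _ hw
  have hstep : floodState G ident (r + 1) v = floodUpdate (nbrIds G ident v) r (σ v) ib := rfl
  rw [hstep, floodUpdate]
  split
  · rename_i h
    left
    obtain ⟨h₁, h₂, h₃⟩ := h.choose_spec
    obtain ⟨w, hw, hwi⟩ := mem_nbrIds.1 h₁
    rw [← hwi, hdel w hw] at h₂ h₃ ⊢
    refine ⟨w, hw, h₂, fun x hx => ?_, rfl⟩
    have := h₃ (ident x) (mem_nbrIds.2 ⟨x, hx, rfl⟩)
    rwa [hdel x hx] at this
  · rename_i h
    refine .inr ⟨rfl, fun x hx => ?_⟩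
    by_contra! hlt
    have hxm : ident x ∈ nbrIds G ident v := mem_nbrIds.2 ⟨x, hx, rfl⟩
    obtain ⟨i, hi, hmin⟩ := Finset.exists_min_image _ (fun i => (ib i).headD 0) ⟨_, hxm⟩
    refine h ⟨i, hi, (hmin _ hxm).trans_lt ?_, hmin⟩
    rwa [hdel x hx]

theorem leader_succ_le (r : ℕ) (v : V) :
    (floodState G ident (r + 1) v).leader ≤ (floodState G ident r v).leader := by
  rcases floodState_succ (G := G) (ident := ident) r v with ⟨w, -, h, -, h'⟩ | ⟨h, -⟩
  · rw [h']; exact h.le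
  · rw [h]

/-- Together with `leader_le`: the leader is the smallest identifier in the ball of radius `r`. -/
theorem exists_ident_eq_leader (hG : G.Connected) (r : ℕ) (v : V) :
    ∃ s, (floodState G ident r v).leader = ident s ∧ G.dist v s ≤ r := by
  induction r generalizing v with
  | zero => exact ⟨v, rfl, by simp⟩
  | succ r ih =>
    rcases floodState_succ (G := G) (ident := ident) r v with ⟨w, hw, -, -, h⟩ | ⟨h, -⟩
    · obtain ⟨s, hs, hd⟩ := ih w
      refine ⟨s, by rw [h]; exact hs, ?_⟩
      have h₁ := hG.dist_triangle (u := v) (v := w) (w := s)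
      rw [SimpleGraph.dist_eq_one_iff_adj.2 hw] at h₁
      omega
    · obtain ⟨s, hs, hd⟩ := ih v
      exact ⟨s, by rw [h, hs], by omega⟩

theorem leader_le (hG : G.Connected) {r : ℕ} {v w : V} (h : G.dist v w ≤ r) :
    (floodState G ident r v).leader ≤ ident w := by
  induction r generalizing v with
  | zero =>
    obtain rfl : v = w := hG.dist_eq_zero_iff.1 (by omega)
    exact le_rfl
  | succ r ih =>
    by_cases hne : v = w
    · exact (leader_succ_le r v).trans (ih (by simp [hne]))
    obtain ⟨x, hx, hxw⟩ := hG.exists_adj_dist_le h hne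
    have h₁ := ih hxw
    rcases floodState_succ (G := G) (ident := ident) r v with ⟨y, -, -, h₂, h₃⟩ | ⟨h₂, h₃⟩
    · rw [h₃]; exact (h₂ x hx).trans h₁
    · rw [h₂]; exact (h₃ x hx).trans h₁

theorem floodState_lev_le (r : ℕ) (v : V) : (floodState G ident r v).lev ≤ r := by
  induction r generalizing v with
  | zero => exact le_rfl
  | succ r ih =>
    rcases floodState_succ (G := G) (ident := ident) r v with ⟨w, -, -, -, h⟩ | ⟨h, -⟩
    · rw [h]; exact Nat.succ_le_succ (ih w)
    · rw [h]; exact (ih v).trans (Nat.le_succ r)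

/-- Leaders strictly decrease at each update and never exceed the node's own identifier, so such a
node has never been updated. -/
theorem floodState_of_leader_eq (hG : G.Connected) (r : ℕ) (v : V)
    (hv : (floodState G ident r v).leader = ident v) :
    (floodState G ident r v).lev = 0 ∧ (floodState G ident r v).par = ident v := by
  induction r with
  | zero => exact ⟨rfl, rfl⟩
  | succ r ih =>
    rcases floodState_succ (G := G) (ident := ident) r v with ⟨w, -, h₁, -, h⟩ | ⟨h, -⟩
    · rw [h] at hv
      have := leader_le (ident := ident) hG (r := r) (v := v) (w := v) (by simp)
      simp only at hv
      omega
    · rw [h] at hv ⊢; exact ih hv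

/-- After `v` adopts `w` as its parent, `w` may move on to a smaller leader, hence the first
alternative. Agreement on the leader rules it out and leaves the level relation. -/
theorem floodState_of_leader_ne (r : ℕ) (v : V)
    (hv : (floodState G ident r v).leader ≠ ident v) :
    ∃ w, G.Adj v w ∧ (floodState G ident r v).par = ident w ∧
      ((floodState G ident r w).leader < (floodState G ident r v).leader ∨
        (floodState G ident r w).leader = (floodState G ident r v).leader ∧
        (floodState G ident r w).lev + 1 = (floodState G ident r v).lev) := by
  induction r with
  | zero => exact absurd rfl hv
  | succ r ih =>
    have hpar : ∀ w m l, (floodState G ident r w).leader < m ∨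
        (floodState G ident r w).leader = m ∧ (floodState G ident r w).lev + 1 = l →
        (floodState G ident (r + 1) w).leader < m ∨
        (floodState G ident (r + 1) w).leader = m ∧
          (floodState G ident (r + 1) w).lev + 1 = l := by
      intro w m l hw
      rcases floodState_succ (G := G) (ident := ident) r w with ⟨x, -, h₁, -, h₂⟩ | ⟨h, -⟩
      · left
        rw [h₂]
        simp only
        omega
      · rwa [h]
    rcases floodState_succ (G := G) (ident := ident) r v with ⟨w, hw, h₁, -, h⟩ | ⟨h, -⟩
    · refine ⟨w, hw, by rw [h], hpar _ _ _ (.inr ?_)⟩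
      rw [h]
      exact ⟨rfl, rfl⟩
    · rw [h] at hv ⊢
      obtain ⟨w, hw, h₁, h₂⟩ := ih hv
      exact ⟨w, hw, h₁, hpar _ _ _ h₂⟩

/-- When all nodes agree on the leader, they have found a spanning tree. -/
theorem exists_parentTree (hG : G.Connected) {r : ℕ}
    (h : ∀ v w, (floodState G ident r v).leader = (floodState G ident r w).leader) :
    ∃ t : ParentTree G, (∀ v, (floodState G ident r v).lev = t.lev v) ∧
      (∀ v, (floodState G ident r v).par = ident (t.par v)) ∧ ∀ v, G.dist v t.root ≤ r := by
  classical
  obtain ⟨v₀⟩ := hG.nonempty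
  obtain ⟨s, hs, -⟩ := exists_ident_eq_leader (ident := ident) hG r v₀
  have hall : ∀ v, (floodState G ident r v).leader = ident s := fun v => (h v v₀).trans hs
  have hex : ∀ v, ∃ w, (floodState G ident r v).par = ident w ∧ (v = s → w = s) ∧
      (v ≠ s → G.Adj v w ∧
        (floodState G ident r w).lev + 1 = (floodState G ident r v).lev) := by
    intro v
    by_cases hv : v = s
    · exact ⟨v, (floodState_of_leader_eq hG r v (by rw [hall, hv])).2, fun _ => hv,
        fun h => absurd hv h⟩
    · obtain ⟨w, hw, h₁, h₂⟩ := floodState_of_leader_ne (G := G) (ident := ident) r v (by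
        rw [hall]; exact fun h => hv (ident.injective h).symm)
      rw [hall, hall] at h₂
      exact ⟨w, h₁, fun h => absurd h hv, fun _ => ⟨hw, (h₂.resolve_left (lt_irrefl _)).2⟩⟩
  choose p hp₁ hp₂ hp₃ using hex
  refine ⟨⟨s, p, fun v => (floodState G ident r v).lev, hp₂ s rfl,
    (floodState_of_leader_eq hG r s (hall s)).1, fun v hv => (hp₃ v hv).1,
    fun v hv => (hp₃ v hv).2⟩, fun _ => rfl, hp₁, fun v => ?_⟩
  obtain ⟨s', hs', hd⟩ := exists_ident_eq_leader (ident := ident) hG r v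
  rw [hall] at hs'
  rw [← ident.injective hs'] at hd
  exact hd

/-- If all nodes near `v` agree on the leader, then all nodes do. -/
theorem leader_eq_of_near (hG : G.Connected) {r : ℕ} {v : V}
    (h : ∀ w, G.dist v w ≤ 2 * r + 1 →
      (floodState G ident r w).leader = (floodState G ident r v).leader) (w : V) :
    (floodState G ident r w).leader = (floodState G ident r v).leader := by
  obtain ⟨s, hs, hvs⟩ := exists_ident_eq_leader (ident := ident) hG r v
  -- No vertex is at distance `r + 1` from `s`: it would be within `2 * r + 1` of `v`, have leader
  -- `ident s`, and so be within `r` of `s`. By connectedness the ball of radius `r` around `s` is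
  -- everything.
  suffices H : ∀ j w, G.dist s w ≤ j → G.dist s w ≤ r by
    have h₁ := H _ w le_rfl
    have h₂ := hG.dist_triangle (u := v) (v := s) (w := w)
    exact h w (by omega)
  intro j
  induction j with
  | zero => intro w hw; omega
  | succ j ih =>
    intro w hw
    by_cases hsw : w = s
    · simp [hsw]
    rw [SimpleGraph.dist_comm] at hw
    obtain ⟨x, hx, hxs⟩ := hG.exists_adj_dist_le hw hsw
    rw [SimpleGraph.dist_comm] at hxs
    have h₁ := ih x hxs
    have h₂ := hG.dist_triangle (u := v) (v := s) (w := x)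
    have h₃ := hG.dist_triangle (u := v) (v := x) (w := w)
    rw [SimpleGraph.dist_eq_one_iff_adj.2 hx.symm] at h₃
    obtain ⟨s', hs', hws⟩ := exists_ident_eq_leader (ident := ident) hG r w
    rw [h w (by omega), hs] at hs'
    rw [ident.injective hs', SimpleGraph.dist_comm]
    exact hws

theorem leader_eq_of_diam_le (hG : G.Connected) {r : ℕ} (hr : ∀ v w, G.dist v w ≤ r) (v w : V) :
    (floodState G ident r v).leader = (floodState G ident r w).leader := by
  obtain ⟨s, hs, -⟩ := exists_ident_eq_leader (ident := ident) hG r v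
  obtain ⟨s', hs', -⟩ := exists_ident_eq_leader (ident := ident) hG r w
  have h₁ := leader_le (ident := ident) hG (hr v s')
  have h₂ := leader_le (ident := ident) hG (hr w s)
  omega

theorem flood_runs {b d : ℕ} (hG : G.Connected) (hb : ∀ v, ident v < 2 ^ b) (hd : d < 2 ^ b) :
    Runs G ident b d (fun v => flood d (ident v) (nbrIds G ident v)) (floodState G ident d) := by
  refine Runs.loop fun r hr v => ⟨by simp, fun x hx => ?_⟩
  change x ∈ [(floodState G ident r v).leader, (floodState G ident r v).lev] at hx
  simp only [List.mem_cons, List.not_mem_nil, or_false] at hx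
  rcases hx with rfl | rfl
  · obtain ⟨s, hs, -⟩ := exists_ident_eq_leader (ident := ident) hG r v
    rw [hs]; exact hb s
  · have := floodState_lev_le (G := G) (ident := ident) r v
    omega

/-- An alarm spreads to all nodes within reach, and there are no false alarms. -/
theorem alarm_runs {b d : ℕ} (hG : G.Connected) {m : V → ℕ} (s : V → Prop)
    (hb : 1 < 2 ^ b) (hm : ∀ v, m v < 2 ^ b) :
    ∃ res, Runs G ident b d (fun v => alarm d (m v) (nbrIds G ident v) (s v)) res ∧
      (∀ v, ¬ res v → ∀ w, G.dist v w ≤ d → m w = m v ∧ ¬ s w) ∧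
      ((∀ v w, m v = m w) → (∀ v, ¬ s v) → ∀ v, ¬ res v) := by
  classical
  set τ := loopState G ident (fun v _ s => [m v, if s then 1 else 0])
    (fun v => alarmUpdate (m v) (nbrIds G ident v)) s
  have hstep : ∀ r v, τ (r + 1) v ↔ τ r v ∨ ∃ w, G.Adj v w ∧ (m w ≠ m v ∨ τ r w) := by
    intro r v
    have h : τ (r + 1) v = alarmUpdate (m v) (nbrIds G ident v) r (τ r v)
      (delivered G ident (fun w => [m w, if τ r w then 1 else 0]) v) := rfl
    rw [h, alarmUpdate]
    refine or_congr_right ⟨?_, ?_⟩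
    · rintro ⟨i, hi, h⟩
      obtain ⟨w, hw, rfl⟩ := mem_nbrIds.1 hi
      rw [delivered_of_adj _ _ _ hw] at h
      exact ⟨w, hw, by simpa using h⟩
    · rintro ⟨w, hw, h⟩
      refine ⟨ident w, mem_nbrIds.2 ⟨w, hw, rfl⟩, ?_⟩
      rw [delivered_of_adj _ _ _ hw]
      simpa using h
  refine ⟨τ d, Runs.loop fun r _ v => ⟨by simp, fun x hx => ?_⟩, fun v => ?_, fun h₁ h₂ => ?_⟩
  · simp only [List.mem_cons, List.not_mem_nil, or_false] at hx
    rcases hx with rfl | rfl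
    · exact hm v
    · split <;> omega
  · generalize d = r
    induction r generalizing v with
    | zero =>
      intro hv w hw
      obtain rfl : v = w := hG.dist_eq_zero_iff.1 (by omega)
      exact ⟨rfl, hv⟩
    | succ r ih =>
      intro hv w hw
      rw [hstep] at hv
      push Not at hv
      by_cases hvw : v = w
      · subst hvw
        exact ih v hv.1 v (by simp)
      · obtain ⟨x, hx, hxw⟩ := hG.exists_adj_dist_le hw hvw
        obtain ⟨h₁, h₂⟩ := hv.2 x hx
        obtain ⟨h₃, h₄⟩ := ih x h₂ w hxw
        exact ⟨h₃.trans h₁, h₄⟩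
  · generalize d = r
    induction r with
    | zero => exact h₂
    | succ r ih =>
      intro v
      rw [hstep]
      rintro (h | ⟨w, -, h | h⟩)
      · exact ih v h
      · exact h (h₁ w v)
      · exact ih w h

end Flood

/-! ### The algorithm -/

open Classical in
/-- The program by which a node finds cuts, once it knows its place in a spanning tree of depth at
most `d`. -/
noncomputable def LocalView.findCuts (E : LocalView) (d : ℕ) :
    NodeProgram (Finset (Finset (Sym2 ℕ))) :=
  (E.gather d E.me).bind fun g =>
    -- The number `(g.2 0).1` from the first pass is the node's own cover count, which completes its
    -- `info` for the second pass.
    (E.gather d (Nat.pair E.me (Nat.pair E.par (g.2 0).1))).bind fun g' =>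
      -- The condition on the level exempts the root, whose subtree no edge leaves.
      (alarm (2 * d + 1) 0 E.nbrs (E.lev ≠ 0 ∧ (g.2 0).1 = 0)).bind fun bridge =>
        done (if bridge then ∅ else E.report g'.1 g'.2)

open Classical in
/-- The program that finds all min-cuts of size two if the diameter is at most `2 ^ k`; it may fail
otherwise. -/
noncomputable def minCutProgram (k me : ℕ) (nbrs : Finset ℕ) :
    NodeProgram (Option (Finset (Finset (Sym2 ℕ)))) :=
  -- On a single vertex `D = 0`, so halting must take no round at all.
  if nbrs = ∅ then done (some ∅) else
    (flood (2 ^ k) me nbrs).bind fun s =>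
      (alarm (2 * 2 ^ k + 1) s.leader nbrs False).bind fun bad =>
        if bad then done none else
          round [s.lev, s.par] fun ib =>
            (LocalView.findCuts ⟨me, nbrs, s.lev, s.par, fun i => (ib i).headD 0,
              fun i => (ib i).getD 1 0⟩ (2 ^ k)).bind fun out => done (some out)

theorem Nat.pair_lt_two_pow {a b s : ℕ} (ha : a < 2 ^ s) (hb : b < 2 ^ s) :
    Nat.pair a b < 2 ^ (2 * s) := by
  refine (Nat.pair_lt_max_add_one_sq a b).trans_le ?_
  rw [mul_comm, pow_mul]
  exact Nat.pow_le_pow_left (max_lt ha hb) 2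

/-! ### Round and bandwidth bounds -/

section Correctness

variable {V : Type} [Fintype V] {G : SimpleGraph V} {ident : V ↪ ℕ} {s d : ℕ}

/-- The inner pair takes `2 * s` bits, the outer one `4 * s`; the width `5 * s` leaves room for the
shift by one in the labels. -/
theorem ParentTree.info_add_one_lt (t : ParentTree G) (hs : 0 < s)
    (hid : ∀ v, ident v < 2 ^ s) (hn : Fintype.card V * Fintype.card V < 2 ^ s) (v : V) :
    t.info ident v + 1 < 2 ^ (5 * s) := by
  have h₁ : (t.cov v).card < 2 ^ s := by
    refine lt_of_le_of_lt ?_ hn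
    rw [← Fintype.card_prod]
    exact Finset.card_le_univ _
  have h₂ := Nat.pair_lt_two_pow (hid (t.par v)) h₁
  have h₃ := Nat.pair_lt_two_pow
    ((hid v).trans_le (Nat.pow_le_pow_right (by norm_num) (by omega))) h₂
  have h₄ : 2 ^ (2 * (2 * s)) < 2 ^ (5 * s) := Nat.pow_lt_pow_right (by norm_num) (by omega)
  exact lt_of_le_of_lt h₃ h₄

theorem LocalView.Valid.findCuts_runs {t : ParentTree G} {E : V → LocalView} (hG : G.Connected)
    (hE : LocalView.Valid t ident E) (hd : ∀ v, t.lev v ≤ d)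
    (hdist : ∀ v, G.dist v t.root ≤ d) (hs : 0 < s) (hid : ∀ v, ident v < 2 ^ s)
    (hn : Fintype.card V * Fintype.card V < 2 ^ s) :
    ∃ out, Runs G ident (5 * s) (6 * d + 5) (fun v => (E v).findCuts d) out ∧
      FindsAllMinCuts G ident 2 out := by
  classical
  have hpow : ∀ {x}, x < 2 ^ s → x + 1 < 2 ^ (5 * s) := by
    intro x hx
    exact lt_of_le_of_lt hx (Nat.pow_lt_pow_right (by norm_num) (by omega))
  obtain ⟨r₁, h₁, -, hc₁⟩ := hE.gather (I := ident) hd (fun v => hpow (hid v))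
    (Nat.lt_of_succ_lt (hpow hn))
  have hcov : ∀ v, ((r₁ v).2 0).1 = (t.cov v).card := fun v => by
    rw [hc₁ v 0 (Nat.zero_le _), ParentTree.crossCount_zero ident.injective]
  obtain ⟨r₂, h₂, hh₂, hc₂⟩ := hE.gather (I := t.info ident) hd
    (t.info_add_one_lt hs hid hn) (Nat.lt_of_succ_lt (hpow hn))
  obtain ⟨r₃, h₃, ha₁, ha₂⟩ := alarm_runs (ident := ident) (b := 5 * s) (d := 2 * d + 1) hG
    (m := fun _ => 0) (fun v => (E v).lev ≠ 0 ∧ ((r₁ v).2 0).1 = 0)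
    (Nat.one_lt_two_pow (by omega)) (fun _ => by positivity)
  refine ⟨fun v => if r₃ v then ∅ else (E v).report (r₂ v).1 (r₂ v).2, ?_, ?_⟩
  · have hT : 6 * d + 5 = (d + 1 + (d + 1 + 0)) + ((d + 1 + (d + 1 + 0)) +
      ((2 * d + 1) + 0)) := by ring
    rw [hT]
    have hme : (fun v => (E v).gather d (ident v)) = fun v => (E v).gather d (E v).me :=
      funext fun v => by rw [hE.me]
    rw [hme] at h₁
    refine h₁.bind ?_
    have hinfo : (fun v => (E v).gather d (t.info ident v)) = fun v => (E v).gather d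
        (Nat.pair (E v).me (Nat.pair (E v).par ((r₁ v).2 0).1)) :=
      funext fun v => by rw [hE.me, hE.par, hcov]; rfl
    rw [hinfo] at h₂
    refine h₂.bind ?_
    have hnb : (fun v => alarm (2 * d + 1) 0 (nbrIds G ident v)
        ((E v).lev ≠ 0 ∧ ((r₁ v).2 0).1 = 0)) = fun v => alarm (2 * d + 1) 0 (E v).nbrs
        ((E v).lev ≠ 0 ∧ ((r₁ v).2 0).1 = 0) := funext fun v => by rw [hE.nbrs]
    rw [hnb] at h₃
    exact h₃.bind (Runs.pure _)
  · have hiff : ∀ v, r₃ v ↔ ∃ u, u ≠ t.root ∧ (t.cov u).card = 0 := by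
      intro v
      constructor
      · intro hv
        by_contra! hne
        refine ha₂ (fun _ _ => rfl) (fun u hu => ?_) v hv
        rw [hE.lev, hcov] at hu
        refine hne u ?_ hu.2
        rintro rfl
        exact hu.1 t.lev_root
      · rintro ⟨u, hu, hu'⟩
        by_contra hv
        -- Through the root any two nodes are within `2 * d`, so the alarm reaches everyone.
        have h₄ := hG.dist_triangle (u := v) (v := t.root) (w := u)
        have h₅ := hdist v
        have h₆ := hdist u
        rw [SimpleGraph.dist_comm] at h₆
        refine (ha₁ v hv u (by omega)).2 ⟨?_, by rw [hcov]; exact hu'⟩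
        rw [hE.lev]
        exact ParentTree.lev_ne_zero hu
    simp only [hiff]
    exact hE.findsAllMinCuts hd hh₂ hc₂

theorem nbrIds_ne_empty (hG : G.Connected) [Nontrivial V] (v : V) : nbrIds G ident v ≠ ∅ := by
  obtain ⟨w, hw⟩ := exists_ne v
  obtain ⟨x, hx, -⟩ := hG.exists_adj_dist_le (Nat.le_succ (G.dist v w)) hw.symm
  exact Finset.ne_empty_of_mem (mem_nbrIds.2 ⟨x, hx, rfl⟩)

theorem minCutProgram_eq (hG : G.Connected) [Nontrivial V] (k : ℕ) :
    (fun v => minCutProgram k (ident v) (nbrIds G ident v)) = open Classical in fun v =>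
    (flood (2 ^ k) (ident v) (nbrIds G ident v)).bind fun s =>
      (alarm (2 * 2 ^ k + 1) s.leader (nbrIds G ident v) False).bind fun bad =>
        if bad then done none else
          round [s.lev, s.par] fun ib =>
            (LocalView.findCuts ⟨ident v, nbrIds G ident v, s.lev, s.par,
              fun i => (ib i).headD 0, fun i => (ib i).getD 1 0⟩ (2 ^ k)).bind
                fun out => done (some out) :=
  funext fun v => if_neg (nbrIds_ne_empty hG v)

/-- A single node without an alarm would already force global agreement; hence all nodes fail
together. -/
theorem minCutProgram_fails (hG : G.Connected) [Nontrivial V] {k : ℕ} (hs : 0 < s)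
    (hid : ∀ v, ident v < 2 ^ s) (hk : 2 ^ k < 2 ^ s)
    (h : ¬ ∀ v w, (floodState G ident (2 ^ k) v).leader =
      (floodState G ident (2 ^ k) w).leader) :
    Runs G ident (5 * s) (2 ^ k + ((2 * 2 ^ k + 1) + 0))
      (fun v => minCutProgram k (ident v) (nbrIds G ident v)) fun _ => none := by
  classical
  have hmono : 2 ^ s ≤ 2 ^ (5 * s) := Nat.pow_le_pow_right (by norm_num) (by omega)
  rw [minCutProgram_eq hG]
  refine (flood_runs hG (fun v => (hid v).trans_le hmono) (hk.trans_le hmono)).bind ?_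
  obtain ⟨res, hr, h₁, -⟩ := alarm_runs (ident := ident) (b := 5 * s) (d := 2 * 2 ^ k + 1) hG
    (m := fun v => (floodState G ident (2 ^ k) v).leader) (fun _ => False)
    (Nat.one_lt_two_pow (by omega)) (fun v => by
      obtain ⟨x, hx, -⟩ := exists_ident_eq_leader (ident := ident) hG (2 ^ k) v
      rw [hx]
      exact (hid x).trans_le hmono)
  refine hr.bind fun v => if_pos ?_
  by_contra hv
  have := leader_eq_of_near hG fun w hw => (h₁ v hv w hw).1
  exact h fun x y => (this x).trans (this y).symm

theorem minCutProgram_succeeds (hG : G.Connected) [Nontrivial V] {k : ℕ} (hs : 0 < s)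
    (hid : ∀ v, ident v < 2 ^ s) (hk : 2 ^ k < 2 ^ s)
    (hn : Fintype.card V * Fintype.card V < 2 ^ s)
    (h : ∀ v w, (floodState G ident (2 ^ k) v).leader =
      (floodState G ident (2 ^ k) w).leader) :
    ∃ out, Runs G ident (5 * s) (2 ^ k + ((2 * 2 ^ k + 1) + ((6 * 2 ^ k + 5 + 0) + 1)))
      (fun v => minCutProgram k (ident v) (nbrIds G ident v)) (fun v => some (out v)) ∧
      FindsAllMinCuts G ident 2 out := by
  classical
  have hmono : 2 ^ s ≤ 2 ^ (5 * s) := Nat.pow_le_pow_right (by norm_num) (by omega)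
  obtain ⟨t, hlev, hpar, hdist⟩ := exists_parentTree hG h
  have hle : ∀ v, t.lev v ≤ 2 ^ k := fun v => hlev v ▸ floodState_lev_le _ v
  set msg : V → List ℕ := fun v =>
    [(floodState G ident (2 ^ k) v).lev, (floodState G ident (2 ^ k) v).par] with hmsg
  have hE : LocalView.Valid t ident fun v => ⟨ident v, nbrIds G ident v,
      (floodState G ident (2 ^ k) v).lev, (floodState G ident (2 ^ k) v).par,
      fun i => (delivered G ident msg v i).headD 0,
      fun i => (delivered G ident msg v i).getD 1 0⟩ := by
    refine ⟨fun _ => rfl, fun _ => rfl, hlev, hpar, fun v w hw => ?_, fun v w hw => ?_⟩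
    · simp only [delivered_of_adj _ _ _ hw]
      exact hlev w
    · simp only [delivered_of_adj _ _ _ hw]
      exact hpar w
  obtain ⟨out, hout, hfind⟩ := hE.findCuts_runs hG hle hdist hs hid hn
  refine ⟨out, ?_, hfind⟩
  rw [minCutProgram_eq hG]
  refine (flood_runs hG (fun v => (hid v).trans_le hmono) (hk.trans_le hmono)).bind ?_
  obtain ⟨res, hr, -, h₂⟩ := alarm_runs (ident := ident) (b := 5 * s) (d := 2 * 2 ^ k + 1) hG
    (m := fun v => (floodState G ident (2 ^ k) v).leader) (fun _ => False)
    (Nat.one_lt_two_pow (by omega)) (fun v => by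
      obtain ⟨x, hx, -⟩ := exists_ident_eq_leader (ident := ident) hG (2 ^ k) v
      rw [hx]
      exact (hid x).trans_le hmono)
  refine hr.bind ?_
  simp only [if_neg (h₂ h (fun _ => not_false) _)]
  refine Runs.step (msg := msg) (fun v => ⟨by simp [hmsg], fun x hx => ?_⟩)
    (hout.bind (T' := 0) (Runs.pure fun v => some (out v)))
  simp only [hmsg, List.mem_cons, List.not_mem_nil, or_false] at hx
  rcases hx with rfl | rfl
  · rw [hlev]
    exact ((hle v).trans_lt hk).trans_le hmono
  · rw [hpar]
    exact (hid _).trans_le hmono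

/-- Keeps the guesses, which stay below `2 * G.diam`, within the message width. -/
theorem SimpleGraph.Connected.diam_lt_card (hG : G.Connected) : G.diam < Fintype.card V := by
  have := hG.nonempty
  obtain ⟨u, v, h⟩ := G.exists_dist_eq_diam
  obtain ⟨p, hp, hl⟩ := hG.exists_path_of_dist u v
  rw [← h, ← hl]
  exact hp.length_lt

theorem search_minCutProgram (hG : G.Connected) [Nontrivial V] (hs : 0 < s)
    (hid : ∀ v, ident v < 2 ^ s) (hs' : 2 * Fintype.card V < 2 ^ s)
    (hn : Fintype.card V * Fintype.card V < 2 ^ s) :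
    (search minCutProgram).UsesBandwidth G ident (3 * (2 * (5 * s) + 1)) ∧
      ∃ out, (search minCutProgram).HaltsWithin G ident (40 * G.diam) out ∧
        FindsAllMinCuts G ident 2 out := by
  classical
  have htop : G.ediam ≠ ⊤ := SimpleGraph.connected_iff_ediam_ne_top.1 hG
  have hD : G.diam ≠ 0 := SimpleGraph.diam_ne_zero_of_ediam_ne_top htop
  have hDn := hG.diam_lt_card
  have hok : ∀ k, G.diam ≤ 2 ^ k → ∀ v w, (floodState G ident (2 ^ k) v).leader =
      (floodState G ident (2 ^ k) w).leader := fun k hk =>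
    leader_eq_of_diam_le hG fun v w => (SimpleGraph.dist_le_diam htop).trans hk
  have hex : ∃ k, ∀ v w, (floodState G ident (2 ^ k) v).leader =
      (floodState G ident (2 ^ k) w).leader := ⟨G.diam, hok _ Nat.lt_two_pow_self.le⟩
  obtain ⟨K, hK, hmin⟩ : ∃ K, (∀ v w, (floodState G ident (2 ^ K) v).leader =
      (floodState G ident (2 ^ K) w).leader) ∧ ∀ k < K, ¬ ∀ v w,
      (floodState G ident (2 ^ k) v).leader = (floodState G ident (2 ^ k) w).leader :=
    ⟨Nat.find hex, Nat.find_spec hex, fun k hk => Nat.find_min hex hk⟩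
  have hlt : ∀ k < K, 2 ^ k < G.diam := fun k hk => by
    by_contra! hle
    exact hmin k hk (hok k hle)
  -- The guess before the accepted one was below the diameter; for `K = 0` the diameter is nonzero.
  have hK2 : 2 ^ K < 2 * G.diam := by
    cases K with
    | zero => omega
    | succ K =>
      have := hlt K (Nat.lt_succ_self K)
      rw [pow_succ]
      omega
  obtain ⟨out, hrun, hfind⟩ := minCutProgram_succeeds hG hs hid (by omega) hn hK
  set T : ℕ → ℕ := fun k => if k = K then
    2 ^ K + ((2 * 2 ^ K + 1) + ((6 * 2 ^ K + 5 + 0) + 1)) else 2 ^ k + ((2 * 2 ^ k + 1) + 0)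
  have hTK : T K = 2 ^ K + ((2 * 2 ^ K + 1) + ((6 * 2 ^ K + 5 + 0) + 1)) := if_pos rfl
  have hTk : ∀ k < K, T k = 2 ^ k + ((2 * 2 ^ k + 1) + 0) := fun k hk => if_neg hk.ne
  have hfail : ∀ k < K, Runs G ident (5 * s) (T k)
      (fun v => minCutProgram k (ident v) (nbrIds G ident v)) fun _ => none := fun k hk => by
    rw [hTk k hk]
    have := hlt k hk
    exact minCutProgram_fails hG hs hid (by omega) (hmin k hk)
  rw [← hTK] at hrun
  have hne : ∀ k ≤ K, ∀ v, minCutProgram k (ident v) (nbrIds G ident v) ≠ done none := by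
    intro k hk v
    rcases hk.eq_or_lt with rfl | hk
    · rw [hTK, ← Nat.add_assoc, ← Nat.add_assoc] at hrun
      exact hrun.ne_done v none
    · have := hfail k hk
      rw [hTk k hk, Nat.add_zero, ← Nat.add_assoc] at this
      exact this.ne_done v none
  -- A failed guess costs `3 * 2 ^ k + 1` rounds; the slack `4` absorbs the extra ones in the
  -- induction. With `9 * 2 ^ K + 7` rounds for the accepted guess, the total is at most `13 * 2 ^ K
  -- + 3`, well below `40 * G.diam`.
  have hsum : ∀ j ≤ K, ∑ k ∈ Finset.range j, T k + 4 ≤ 4 * 2 ^ j := by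
    intro j
    induction j with
    | zero => intro _; simp
    | succ j ih =>
      intro hj
      have h₁ := ih (by omega)
      have h₂ : 1 ≤ 2 ^ j := Nat.one_le_two_pow
      rw [Finset.sum_range_succ, hTk j (by omega), pow_succ]
      omega
  obtain ⟨h₁, h₂⟩ := search_spec minCutProgram (T' := 40 * G.diam)
    (fun k hk => hne (k + 1) hk) (hne 0 (Nat.zero_le K)) hfail hrun (by
      have h₁ := hsum K le_rfl
      have h₂ : 1 ≤ 2 ^ K := Nat.one_le_two_pow
      rw [Finset.sum_range_succ, hTK]
      omega)
  exact ⟨h₁, out, h₂, hfind⟩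

theorem search_minCutProgram_of_subsingleton [Subsingleton V] (T : ℕ) (b : ℕ) :
    (search minCutProgram).UsesBandwidth G ident b ∧
      ∃ out, (search minCutProgram).HaltsWithin G ident T out ∧
        FindsAllMinCuts G ident 2 out := by
  have hnbr : ∀ v, nbrIds G ident v = ∅ := fun v => by
    refine Finset.eq_empty_of_forall_notMem fun i hi => ?_
    obtain ⟨w, hw, -⟩ := mem_nbrIds.1 hi
    exact G.ne_of_adj hw (Subsingleton.elim _ _)
  have hprog : ∀ v, minCutProgram 0 (ident v) (nbrIds G ident v) = done (some ∅) := fun v =>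
    if_pos (hnbr v)
  refine ⟨fun t u v h => absurd (Subsingleton.elim u v) (G.ne_of_adj h), fun _ => ∅, ?_, ?_⟩
  · exact (search_spec (b := 0) minCutProgram (K := 0) (T := fun _ => 0)
      (out := fun _ : V => (∅ : Finset (Finset (Sym2 ℕ)))) (fun k hk => absurd hk (by simp))
      (fun v => by rw [hprog v]; simp) (fun k hk => absurd hk (by simp)) hprog (by simp)).2
  · refine ⟨fun v S hS => absurd hS (Finset.notMem_empty S), fun F hF _ => ?_⟩
    obtain ⟨⟨A, ⟨a, ha⟩, hne, -⟩, -⟩ := hF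
    exact absurd (Finset.eq_univ_of_forall fun x => Subsingleton.elim a x ▸ ha) hne

end Correctness

theorem mainTheorem2 :
    ∃ (A : DistributedAlgorithm (Finset (Finset (Sym2 ℕ)))) (C : ℕ), ∀ c : ℕ, ∃ B : ℕ,
      ∀ (V : Type) [Fintype V] (G : SimpleGraph V) (ident : V ↪ ℕ), G.Connected →
        (∀ v, Nat.size (ident v) ≤ c * Nat.log 2 (Fintype.card V)) →
          A.UsesBandwidth G ident (B * Nat.log 2 (Fintype.card V)) ∧
            ∃ out : V → Finset (Finset (Sym2 ℕ)),
              A.HaltsWithin G ident (C * G.diam) out ∧ FindsAllMinCuts G ident 2 out := by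
  -- With `s = (c + 4) * L`, the part `c * L` covers the identifiers and `4 * L` covers `n * n` and
  -- `2 * n`. The bandwidth is `30 * s + 3`, and `L ≥ 1` absorbs the final `3`.
  refine ⟨search minCutProgram, 40, fun c => ⟨30 * (c + 4) + 3, ?_⟩⟩
  intro V _ G ident hG hid
  rcases subsingleton_or_nontrivial V with hV | hV
  · exact search_minCutProgram_of_subsingleton _ _
  set n := Fintype.card V with hn
  set L := Nat.log 2 n with hL
  have hn2 : 2 ≤ n := Fintype.one_lt_card
  have hL1 : 1 ≤ L := Nat.log_pos (by norm_num) hn2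
  have hnL : n < 2 ^ (L + 1) := Nat.lt_pow_succ_log_self (by norm_num) n
  have hs : ∀ j ≤ 4 * L, 2 ^ j ≤ 2 ^ ((c + 4) * L) := fun j hj =>
    Nat.pow_le_pow_right (by norm_num) (hj.trans (by nlinarith))
  obtain ⟨h₁, h₂⟩ := search_minCutProgram (s := (c + 4) * L) hG (by positivity)
    (fun v => (Nat.size_le.1 (hid v)).trans_le
      (Nat.pow_le_pow_right (by norm_num) (by nlinarith)))
    (by
      refine lt_of_lt_of_le ?_ (hs (L + 2) (by omega))
      rw [pow_succ]
      omega)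
    (by
      refine lt_of_lt_of_le ?_ (hs ((L + 1) + (L + 1)) (by omega))
      rw [pow_add]
      exact Nat.mul_lt_mul'' hnL hnL)
  refine ⟨fun t u v h => (h₁ t u v h).trans ?_, h₂⟩
  nlinarith
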